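/- In a $2$-coloring $f\colon V(G)\to\{\text{red},\text{blue}\}$ of the vertices of a finite simple graph $G$, an edge is called red (blue) if both of its end vertices are red (blue). The problem $2$-Load Coloring asks, given a graph $G$ and integers $k_1,k_2$, whether $G$ has a $2$-coloring with at least $k_1$ red edges and at least $k_2$ blue edges. A cluster graph is a disjoint union of complete graphs, and a co-cluster graph is the complement of a cluster graph. The distance of $G$ to co-cluster graphs is the minimum number of vertices whose deletion from $G$ leaves a co-cluster graph. Theorem. $2$-Load Coloring is fixed-parameter tractable parameterized by the distance $d$ of the input graph to co-cluster graphs: there is an algorithm that decides every instance $(G,k_1,k_2)$ in time $f(d)\cdot N^{O(1)}$, where $N$ is the length of the input and $f$ is a computable function. Moreover, if a set $X\subseteq V(G)$ such that $G-X$ is a co-cluster graph is given with the input, then the problem is decided in time $O(2^{k}n^{4}m^{2})$, where $k=|X|$, $n=|V(G)|$ and $m=|E(G)|$ (in this bound a factor $n$ or $m$ that is $0$ is read as $1$). Time is the number of steps of a random access machine with uniform cost whose arithmetic operations are addition and truncated subtraction of natural numbers; the input consists of $n$, $k_1$, $k_2$, the adjacency matrix of $G$ and, in the second part, the indicator vector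 of $X$. -/

import Mathlib

/-! ### Random access machines with uniform cost

Programs are structured (sequencing, branching, loops) and use finitely many registers and finitely
many unbounded arrays, all holding natural numbers. The only arithmetic operations are addition and
truncated subtraction. Every elementary instruction and every test costs one step. -/

namespace RAM

/-- Comparisons between the contents of two registers. -/
inductive Test : Type
  | lt (x y : ℕ)
  | eq (x y : ℕ)

/-- Random access programs. Registers and arrays are named by natural numbers; the names are part of
the program, so that each program uses only finitely many of them. Only `load` and `store` access
the arrays, at the index held by a register. -/
inductive Prog : Type
  /-- do nothing -/
  | skip
  /-- `r := c` for a constant `c` -/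
  | const (r c : ℕ)
  /-- `r := x` -/
  | copy (r x : ℕ)
  /-- `r := x + y` -/
  | add (r x y : ℕ)
  /-- `r := x - y`, or `0` if `x < y` -/
  | sub (r x y : ℕ)
  /-- `r := a[i]`, where `a` is an array and `i` a register -/
  | load (r a i : ℕ)
  /-- `a[i] := x`, where `a` is an array and `i`, `x` are registers -/
  | store (a i x : ℕ)
  /-- first `p`, then `q` -/
  | seq (p q : Prog)
  /-- if `b` then `p` else `q` -/
  | ite (b : Test) (p q : Prog)
  /-- while `b` do `p` -/
  | loop (b : Test) (p : Prog)

/-- A memory state: `reg r` is the content of register `r`, and `arr a i` is the content of cell `i`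
of array `a`. -/
@[ext]
structure State where
  reg : ℕ → ℕ
  arr : ℕ → ℕ → ℕ

/-- Change the content of register `r` to `v`. -/
def State.setReg (s : State) (r v : ℕ) : State :=
  { s with reg := Function.update s.reg r v }

/-- Change the content of cell `i` of array `a` to `v`. -/
def State.setArr (s : State) (a i v : ℕ) : State :=
  { s with arr := Function.update s.arr a (Function.update (s.arr a) i v) }

/-- The test succeeds in the given state. -/
def Test.holds : Test → State → Prop
  | .lt x y, s => s.reg x < s.reg y
  | .eq x y, s => s.reg x = s.reg y

/-- `Exec p s t s'`: started in state `s`, the program `p` halts after exactly `t` steps,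
in state `s'`. -/
inductive Exec : Prog → State → ℕ → State → Prop
  | skip (s : State) : Exec .skip s 1 s
  | const (s : State) (r c : ℕ) : Exec (.const r c) s 1 (s.setReg r c)
  | copy (s : State) (r x : ℕ) : Exec (.copy r x) s 1 (s.setReg r (s.reg x))
  | add (s : State) (r x y : ℕ) : Exec (.add r x y) s 1 (s.setReg r (s.reg x + s.reg y))
  | sub (s : State) (r x y : ℕ) : Exec (.sub r x y) s 1 (s.setReg r (s.reg x - s.reg y))
  | load (s : State) (r a i : ℕ) : Exec (.load r a i) s 1 (s.setReg r (s.arr a (s.reg i)))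
  | store (s : State) (a i x : ℕ) : Exec (.store a i x) s 1 (s.setArr a (s.reg i) (s.reg x))
  | seq {p q : Prog} {s₁ s₂ s₃ : State} {t₁ t₂ : ℕ} :
      Exec p s₁ t₁ s₂ → Exec q s₂ t₂ s₃ → Exec (.seq p q) s₁ (t₁ + t₂) s₃
  | ite_true {b : Test} {p q : Prog} {s s' : State} {t : ℕ} :
      b.holds s → Exec p s t s' → Exec (.ite b p q) s (t + 1) s'
  | ite_false {b : Test} {p q : Prog} {s s' : State} {t : ℕ} :
      ¬ b.holds s → Exec q s t s' → Exec (.ite b p q) s (t + 1) s'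
  | loop_false {b : Test} {p : Prog} {s : State} :
      ¬ b.holds s → Exec (.loop b p) s 1 s
  | loop_true {b : Test} {p : Prog} {s₁ s₂ s₃ : State} {t₁ t₂ : ℕ} :
      b.holds s₁ → Exec p s₁ t₁ s₂ → Exec (.loop b p) s₂ t₂ s₃ →
        Exec (.loop b p) s₁ (t₁ + t₂ + 1) s₃

/-- The initial state on input `w`: the word `w` is stored in array `0`, everything else is `0`. -/
def initial (w : List ℕ) : State where
  reg := fun _ => 0
  arr := fun a i => if a = 0 then w.getD i 0 else 0

/-- On input `w`, the program `p` halts after at most `T` steps, with the correct answer to the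
question `Q` in register `0`: the answer is `1` if `Q` is true and `0` if `Q` is false. -/
def AnswersWithin (p : Prog) (w : List ℕ) (Q : Prop) (T : ℕ) : Prop :=
  ∃ (t : ℕ) (s : State), Exec p (initial w) t s ∧ t ≤ T ∧
    (Q → s.reg 0 = 1) ∧ (¬ Q → s.reg 0 = 0)

end RAM

/-- A parameterized decision problem: instances, their encoding as words over `ℕ`, the set of
yes-instances, and the parameter of an instance. -/
structure ParameterizedProblem where
  Inst : Type
  encode : Inst → List ℕ
  yes : Inst → Prop
  param : Inst → ℕ

/-- Fixed-parameter tractability: one program decides every instance `x` in at most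
`f (param x) * N ^ c` steps, where `N` is the length of the input, `c` is a constant and `f` is a
computable function. The value of the parameter is not given to the program. -/
def ParameterizedProblem.IsFPT (P : ParameterizedProblem) : Prop :=
  ∃ (p : RAM.Prog) (f : ℕ → ℕ) (c : ℕ), Computable f ∧
    ∀ x : P.Inst, RAM.AnswersWithin p (P.encode x) (P.yes x)
      (f (P.param x) * (P.encode x).length ^ c)

/-! ### Cluster graphs, co-cluster graphs and the distance to them -/

/-- A cluster graph is a disjoint union of complete graphs: every connected component is
complete. -/
def IsCluster {V : Type*} (G : SimpleGraph V) : Prop :=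
  ∀ u v : V, G.Reachable u v → u ≠ v → G.Adj u v

/-- A co-cluster graph is the complement of a cluster graph. -/
def IsCocluster {V : Type*} (G : SimpleGraph V) : Prop :=
  IsCluster Gᶜ

/-- `G - X` is a co-cluster graph. -/
def IsCoclusterModulator {V : Type*} (G : SimpleGraph V) (X : Finset V) : Prop :=
  IsCocluster (G.induce {v : V | v ∉ X})

/-- The distance of `G` to co-cluster graphs: the minimum number of vertices that have to be deleted
in order to obtain a co-cluster graph. -/
noncomputable def distToCocluster {V : Type*} (G : SimpleGraph V) : ℕ :=
  sInf {k : ℕ | ∃ X : Finset V, X.card = k ∧ IsCoclusterModulator G X}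

/-! ### The problem 2-Load Coloring -/

/-- The two colors. -/
inductive Color : Type
  | red
  | blue

/-- The number of edges both of whose end vertices have color `c`. -/
noncomputable def monoEdges {V : Type*} (G : SimpleGraph V) (f : V → Color) (c : Color) : ℕ :=
  {e : Sym2 V | e ∈ G.edgeSet ∧ ∀ v ∈ e, f v = c}.ncard

/-- `G` has a 2-coloring with at least `k₁` red edges and at least `k₂` blue edges. -/
def HasLoadColoring {V : Type*} (G : SimpleGraph V) (k₁ k₂ : ℤ) : Prop :=
  ∃ f : V → Color, k₁ ≤ (monoEdges G f .red : ℤ) ∧ k₂ ≤ (monoEdges G f .blue : ℤ)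

/-- An instance of 2-Load Coloring: a graph with vertices `0, …, n - 1` and two integers. -/
structure LoadInstance where
  n : ℕ
  G : SimpleGraph (Fin n)
  k₁ : ℤ
  k₂ : ℤ

open Classical in
/-- The encoding of an instance: the number of vertices, the two integers (each as its positive and
its negative part), and the adjacency matrix of the graph, row by row. -/
noncomputable def LoadInstance.encode (I : LoadInstance) : List ℕ :=
  [I.n, I.k₁.toNat, (-I.k₁).toNat, I.k₂.toNat, (-I.k₂).toNat] ++
    List.ofFn (fun e : Fin (I.n * I.n) => if I.G.Adj e.divNat e.modNat then 1 else 0)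

open Classical in
/-- The encoding of an instance together with a set `X` of vertices, given by its indicator
vector. -/
noncomputable def LoadInstance.encodeWith (I : LoadInstance) (X : Finset (Fin I.n)) : List ℕ :=
  I.encode ++ List.ofFn (fun v : Fin I.n => if v ∈ X then 1 else 0)

/-- 2-Load Coloring parameterized by the distance to co-cluster graphs. -/
noncomputable def loadColoringByCocluster : ParameterizedProblem where
  Inst := LoadInstance
  encode := LoadInstance.encode
  yes I := HasLoadColoring I.G I.k₁ I.k₂
  param I := distToCocluster I.G

/-! After deletion of a modulator `X` the graph is complete multipartite: non-adjacency is an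
equivalence relation whose classes are the parts. Fix one of the `2 ^ |X|` colorings of `X` and
color the other vertices part by part. A new vertex `j` is adjacent to all vertices of the finished
parts and to none of its own part. If the finished parts have `st` vertices, `r` of them red, then a
red `j` creates one red edge for each of its red neighbors in `X`, and `r` more; a blue `j` creates
one blue edge for each of its blue neighbors in `X`, and `st - r` more. So a state consists only of
`r`, the number `q` of red vertices in the current part, and the numbers `e₁`, `e₂` of red and blue
ordered adjacent pairs (twice the numbers of edges). `CoclusterInput.sum_seen_nbrs` is this
observation; `CoclusterInput.reached_step` and `reached_end` turn it into recursions for the set of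
reachable states, and `CoclusterInput.exists_reached_iff` reads off the answer.

States are coded in mixed radix as `r * wR + q * wQ + e₁ * wE + e₂`, where `wE = 1 + 2m`, `wQ = wE²`
and `wR = (n + 1) * wQ`. For fixed `r`, each way of coloring `j` adds a constant to the code. Hence
a machine without multiplication and division can carry out a transition by copying blocks of cells.
A layer has `(n + 1)² * wE²` cells; charging one layer to each of the `n²` pairs of a part index and
a vertex gives the factor `n⁴m²`.

If no modulator is given, one is found greedily. A graph is co-cluster iff no three of its vertices
induce an edge and an isolated vertex. Collecting disjoint triples of this kind until none is left
yields a modulator, and every modulator meets every collected triple. So its size is at most `3d`,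
and `2 ^ (3d) = 8 ^ d`. -/

namespace RAM

/-! ### Bounded execution, frames and counting loops -/

infixr:60 ";;" => Prog.seq

instance (b : Test) (s : State) : Decidable (b.holds s) := by
  cases b <;> unfold Test.holds <;> infer_instance

/-- The registers that a program may change. -/
def Prog.regs : Prog → List ℕ
  | .skip => []
  | .const r _ => [r]
  | .copy r _ => [r]
  | .add r _ _ => [r]
  | .sub r _ _ => [r]
  | .load r _ _ => [r]
  | .store _ _ _ => []
  | .seq p q => p.regs ++ q.regs
  | .ite _ p q => p.regs ++ q.regs
  | .loop _ p => p.regs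

/-- The arrays that a program may change. -/
def Prog.arrs : Prog → List ℕ
  | .store a _ _ => [a]
  | .seq p q => p.arrs ++ q.arrs
  | .ite _ p q => p.arrs ++ q.arrs
  | .loop _ p => p.arrs
  | _ => []

/-- `s'` differs from `s` only in registers and arrays that `p` may change. -/
structure Frame (p : Prog) (s s' : State) : Prop where
  reg : ∀ r, r ∉ p.regs → s'.reg r = s.reg r
  arr : ∀ a, a ∉ p.arrs → s'.arr a = s.arr a

@[simp] theorem State.setReg_reg (s : State) (r v x : ℕ) :
    (s.setReg r v).reg x = if x = r then v else s.reg x := by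
  simp [State.setReg, Function.update_apply]

@[simp] theorem State.setReg_arr (s : State) (r v : ℕ) : (s.setReg r v).arr = s.arr := rfl

@[simp] theorem State.setArr_reg (s : State) (a i v : ℕ) : (s.setArr a i v).reg = s.reg := rfl

@[simp] theorem State.setArr_arr (s : State) (a i v b : ℕ) :
    (s.setArr a i v).arr b = if b = a then Function.update (s.arr a) i v else s.arr b := by
  simp [State.setArr, Function.update_apply]

/-- Register and array names are fixed in the program text, so non-interference is syntactic. The
many later `by decide` obligations are membership tests in the lists `regs` and `arrs`. -/
theorem Exec.frame {p : Prog} {s s' : State} {t : ℕ} (h : Exec p s t s') : Frame p s s' := by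
  induction h with
  | skip => exact ⟨fun _ _ => rfl, fun _ _ => rfl⟩
  | const | copy | add | sub | load =>
    exact ⟨fun r hr => by simp_all [Prog.regs], fun _ _ => rfl⟩
  | store => exact ⟨fun _ _ => rfl, fun a ha => by simp_all [Prog.arrs]⟩
  | seq _ _ h1 h2 =>
    refine ⟨fun r hr => ?_, fun a ha => ?_⟩
    · simp only [Prog.regs, List.mem_append, not_or] at hr
      rw [h2.reg r hr.2, h1.reg r hr.1]
    · simp only [Prog.arrs, List.mem_append, not_or] at ha
      rw [h2.arr a ha.2, h1.arr a ha.1]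
  | ite_true _ _ h1 | ite_false _ _ h1 =>
    refine ⟨fun r hr => ?_, fun a ha => ?_⟩
    · simp only [Prog.regs, List.mem_append, not_or] at hr
      first | exact h1.reg r hr.1 | exact h1.reg r hr.2
    · simp only [Prog.arrs, List.mem_append, not_or] at ha
      first | exact h1.arr a ha.1 | exact h1.arr a ha.2
  | loop_false => exact ⟨fun _ _ => rfl, fun _ _ => rfl⟩
  | loop_true _ _ _ h1 h2 =>
    exact ⟨fun r hr => by rw [h2.reg r hr, h1.reg r hr],
      fun a ha => by rw [h2.arr a ha, h1.arr a ha]⟩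

/-- Started in `s`, the program `p` halts within `T` steps in a state that satisfies `Q`. -/
def Runs (p : Prog) (s : State) (T : ℕ) (Q : State → Prop) : Prop :=
  ∃ (t : ℕ) (s' : State), Exec p s t s' ∧ t ≤ T ∧ Q s'

/-- The postcondition may use the frame, so `Q` need not mention what the program leaves alone. -/
theorem Runs.weaken {p : Prog} {s : State} {T T' : ℕ} {Q Q' : State → Prop} (h : Runs p s T Q)
    (hT : T ≤ T') (hQ : ∀ s', Frame p s s' → Q s' → Q' s') : Runs p s T' Q' := by
  obtain ⟨t, s', he, ht, hq⟩ := h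
  exact ⟨t, s', he, ht.trans hT, hQ s' he.frame hq⟩

theorem Runs.seq {p q : Prog} {s : State} {T₁ T₂ : ℕ} {R Q : State → Prop} (h : Runs p s T₁ R)
    (h' : ∀ s', Frame p s s' → R s' → Runs q s' T₂ Q) : Runs (p;;q) s (T₁ + T₂) Q := by
  obtain ⟨t, s', he, ht, hr⟩ := h
  obtain ⟨t', s'', he', ht', hq⟩ := h' s' he.frame hr
  exact ⟨t + t', s'', he.seq he', by omega, hq⟩

theorem Runs.ite {b : Test} {p q : Prog} {s : State} {T : ℕ} {Q : State → Prop}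
    (h : b.holds s → Runs p s T Q) (h' : ¬ b.holds s → Runs q s T Q) :
    Runs (.ite b p q) s (T + 1) Q := by
  by_cases hb : b.holds s
  · obtain ⟨t, s', he, ht, hq⟩ := h hb
    exact ⟨t + 1, s', .ite_true hb he, by omega, hq⟩
  · obtain ⟨t, s', he, ht, hq⟩ := h' hb
    exact ⟨t + 1, s', .ite_false hb he, by omega, hq⟩

/-- The program contains no loop. -/
def Prog.loopFree : Prog → Bool
  | .seq p q => p.loopFree && q.loopFree
  | .ite _ p q => p.loopFree && q.loopFree
  | .loop _ _ => false
  | _ => true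

/-- The result of a loop-free program. -/
def Prog.eval : Prog → State → State
  | .skip, s => s
  | .const r c, s => s.setReg r c
  | .copy r x, s => s.setReg r (s.reg x)
  | .add r x y, s => s.setReg r (s.reg x + s.reg y)
  | .sub r x y, s => s.setReg r (s.reg x - s.reg y)
  | .load r a i, s => s.setReg r (s.arr a (s.reg i))
  | .store a i x, s => s.setArr a (s.reg i) (s.reg x)
  | .seq p q, s => q.eval (p.eval s)
  | .ite b p q, s => if b.holds s then p.eval s else q.eval s
  | .loop _ _, s => s

/-- An upper bound on the running time of a loop-free program. -/
def Prog.cost : Prog → ℕ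
  | .seq p q => p.cost + q.cost
  | .ite _ p q => max p.cost q.cost + 1
  | _ => 1

theorem Prog.exec_eval (p : Prog) (hp : p.loopFree = true) (s : State) :
    ∃ t ≤ p.cost, Exec p s t (p.eval s) := by
  induction p generalizing s with
  | skip => exact ⟨1, le_rfl, .skip s⟩
  | const r c => exact ⟨1, le_rfl, .const s r c⟩
  | copy r x => exact ⟨1, le_rfl, .copy s r x⟩
  | add r x y => exact ⟨1, le_rfl, .add s r x y⟩
  | sub r x y => exact ⟨1, le_rfl, .sub s r x y⟩
  | load r a i => exact ⟨1, le_rfl, .load s r a i⟩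
  | store a i x => exact ⟨1, le_rfl, .store s a i x⟩
  | seq p q hp' hq' =>
    simp only [Prog.loopFree, Bool.and_eq_true] at hp
    obtain ⟨t, ht, he⟩ := hp' hp.1 s
    obtain ⟨t', ht', he'⟩ := hq' hp.2 (p.eval s)
    exact ⟨t + t', by simp only [Prog.cost]; omega, he.seq he'⟩
  | ite b p q hp' hq' =>
    simp only [Prog.loopFree, Bool.and_eq_true] at hp
    by_cases hb : b.holds s
    · obtain ⟨t, ht, he⟩ := hp' hp.1 s
      exact ⟨t + 1, by simp only [Prog.cost]; omega,
        by simpa only [Prog.eval, hb, if_true] using Exec.ite_true hb he⟩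
    · obtain ⟨t, ht, he⟩ := hq' hp.2 s
      exact ⟨t + 1, by simp only [Prog.cost]; omega,
        by simpa only [Prog.eval, hb, if_false] using Exec.ite_false hb he⟩
  | loop b p => simp [Prog.loopFree] at hp

/-- Loop-free code is verified by computing its final state; only loops need invariants. -/
theorem Runs.eval {p : Prog} {s : State} {T : ℕ} {Q : State → Prop} (hp : p.loopFree = true)
    (hT : p.cost ≤ T) (hQ : Q (p.eval s)) : Runs p s T Q := by
  obtain ⟨t, ht, he⟩ := p.exec_eval hp s
  exact ⟨t, _, he, ht.trans hT, hQ⟩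

notation "rTmp" => 63

/-- Increment a register. -/
def Prog.inc (r : ℕ) : Prog := .const rTmp 1;; .add r r rTmp

/-- `for i := 0, 1, …, b - 1 do p`. -/
def Prog.forLt (i b : ℕ) (p : Prog) : Prog :=
  .const i 0;; .loop (.lt i b) (p;; .inc i)

/-- Invariant rule for counting loops. The body has to establish the invariant in the state after
the increment, whence the two `setReg`. Each round costs 3 steps besides the body (the test and the
two steps of `inc`); the final 2 are the initialization and the failing test. -/
theorem Runs.forLt {i b : ℕ} {p : Prog} {s : State} {T : ℕ} {I : ℕ → State → Prop}
    (hreg : i ∉ p.regs ∧ b ∉ p.regs ∧ i ≠ b ∧ i ≠ rTmp ∧ b ≠ rTmp)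
    (h0 : I 0 (s.setReg i 0))
    (hs : ∀ k s', k < s.reg b → Frame (.forLt i b p) s s' → s'.reg i = k → I k s' →
      Runs p s' T (fun s'' => I (k + 1) ((s''.setReg rTmp 1).setReg i (k + 1)))) :
    Runs (.forLt i b p) s (s.reg b * (T + 3) + 2) (I (s.reg b)) := by
  obtain ⟨hi, hb, hib, hit, hbt⟩ := hreg
  -- Induction on the number `m` of remaining rounds. The frame back to the initial state `s` is
  -- carried along, so that the body can use everything known before the loop.
  have key : ∀ m k s', k + m = s.reg b → Frame (.forLt i b p) s s' → s'.reg i = k → I k s' →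
      ∃ t s'', Exec (.loop (.lt i b) (p;; .inc i)) s' t s'' ∧ t ≤ m * (T + 3) + 1 ∧
        I (s.reg b) s'' := by
    intro m
    induction m with
    | zero =>
      intro k s' hk hf hik hI
      have hbs : s'.reg b = s.reg b := hf.reg b (by
        simp [Prog.forLt, Prog.inc, Prog.regs, hb, Ne.symm hib, hbt])
      refine ⟨1, s', .loop_false ?_, by omega, by rwa [← hk]⟩
      simp only [Test.holds]; omega
    | succ m ih =>
      intro k s' hk hf hik hI
      have hbs : s'.reg b = s.reg b := hf.reg b (by
        simp [Prog.forLt, Prog.inc, Prog.regs, hb, Ne.symm hib, hbt])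
      obtain ⟨t, s₁, he, ht, hq⟩ := hs k s' (by omega) hf hik hI
      have hi1 : s₁.reg i = k := by rw [he.frame.reg i hi, hik]
      have hinc : Exec (.inc i) s₁ (1 + 1) ((s₁.setReg rTmp 1).setReg i (k + 1)) := by
        have h1 := Exec.const s₁ rTmp 1
        have h2 := Exec.add (s₁.setReg rTmp 1) i i rTmp
        simp only [State.setReg_reg, hit, if_false, if_true, hi1] at h2
        exact h1.seq h2
      have hbody := he.seq hinc
      obtain ⟨t', s₂, he', ht', hq'⟩ := ih (k + 1) _ (by omega) (by
        refine ⟨fun r hr => ?_, fun a ha => ?_⟩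
        · rw [hbody.frame.reg r (by
            simp only [Prog.forLt, Prog.regs, List.mem_append, not_or] at hr ⊢; exact hr.2)]
          exact hf.reg r hr
        · rw [hbody.frame.arr a (by
            simp only [Prog.forLt, Prog.arrs, List.mem_append, not_or] at ha ⊢; exact ha.2)]
          exact hf.arr a ha) (by simp) hq
      refine ⟨_, s₂, .loop_true ?_ hbody he', ?_, hq'⟩
      · simp only [Test.holds]; omega
      · rw [Nat.add_mul]; omega
  have hc := Exec.const s i 0
  obtain ⟨t, s', he, ht, hq⟩ := key (s.reg b) 0 _ (by omega) (by
    refine ⟨fun r hr => hc.frame.reg r ?_, fun a ha => rfl⟩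
    simp only [Prog.forLt, Prog.regs, List.mem_append, not_or] at hr ⊢; exact hr.1) (by simp) h0
  exact ⟨1 + t, s', hc.seq he, by omega, hq⟩

/-! ### The programs -/

-- Register `0` holds the answer. Array `0` is the input, `1` the powers of two on the given set,
-- `2` the part representatives, `3` the current coloring of the given set, `4` the table and `5`
-- the row offsets of the adjacency matrix.
notation "rN" => 1
notation "rXO" => 2
notation "rW" => 3
notation "rWW" => 4
notation "rQ" => 5
notation "rR" => 6
notation "rB" => 7
notation "rK1" => 8
notation "rK2" => 9
notation "rK" => 10
notation "rNS" => 11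
notation "rBase" => 12
notation "rNew" => 13
notation "rSt" => 14
notation "rSt2" => 15
notation "rC" => 16
notation "rI" => 17
notation "rJ" => 18
notation "rU" => 19
notation "rV" => 20
notation "rZ" => 21
notation "rBS" => 22
notation "rBD" => 23
notation "rBL" => 24
notation "rX" => 25
notation "rSrc" => 26
notation "rD1" => 27
notation "rD2" => 28
notation "rLim" => 29
notation "rRr" => 30
notation "rQq" => 31
notation "rRem" => 32
notation "rPtr" => 33
notation "rT" => 40
notation "rCU" => 41
notation "rCV" => 42
notation "rOne" => 43

namespace Prog

/-- Compare a register with a constant. -/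
def ifEq (r c : ℕ) (p q : Prog) : Prog := .const rOne c;; .ite (.eq r rOne) p q

/-- `rT := 1` if `u`, `v` are adjacent. -/
def fetch (u v : ℕ) : Prog := .load rT 5 u;; .add rT rT v;; .load rT 0 rT

/-- `rT := 1` if `v` belongs to the vertex set given with the input. -/
def fetchX (v : ℕ) : Prog := .add rT rXO v;; .load rT 0 rT

/-- Read the number of vertices and compute the positions of the rows of the adjacency matrix. -/
def setupRows : Prog :=
  (.const rT 0;; .load rN 0 rT;; .const rXO 5);;
  forLt rU rN (.store 5 rU rXO;; .add rXO rXO rN)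

/-- Put three vertices into the vertex set. -/
def markTriple : Prog :=
  .const rOne 1;; .add rT rXO rU;; .store 0 rT rOne;; .add rT rXO rV;; .store 0 rT rOne;;
  .add rT rXO rZ;; .store 0 rT rOne

/-- Put three vertices into the vertex set if they induce an edge and an isolated vertex. -/
def hitTriple : Prog :=
  fetchX rU;; ifEq rT 1 .skip (fetchX rV;; ifEq rT 1 .skip (fetchX rZ;; ifEq rT 1 .skip
    (fetch rU rV;; ifEq rT 1 (fetch rU rZ;; ifEq rT 1 .skip (fetch rV rZ;; ifEq rT 1 .skip
      markTriple)) .skip)))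

/-- Compute a set of vertices whose deletion leaves a co-cluster graph. -/
def greedy : Prog := forLt rU rN (forLt rV rN (forLt rZ rN hitTriple))

/-- Read `k₁` and `k₂` and double them. -/
def setupTargets : Prog :=
  .const rT 1;; .load rK1 0 rT;; .add rK1 rK1 rK1;;
  .const rT 3;; .load rK2 0 rT;; .add rK2 rK2 rK2;;
  .copy rNS rN;; inc rNS;; .const 0 0;; .const rBase 0;; .const rW 1

/-- Count the ordered pairs of adjacent vertices. -/
def countPairs : Prog :=
  forLt rU rN (forLt rV rN (fetch rU rV;; ifEq rT 1 (inc rW) .skip))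

/-- Compute the weights of the components of the state of the dynamic program. -/
def setupWeights : Prog :=
  (.add rWW rW rW;; .const rQ 0);; forLt rU rW (.add rQ rQ rW);;
  .const rR 0;; forLt rU rNS (.add rR rR rQ);;
  .const rB 0;; forLt rU rNS (.add rB rB rR)

/-- Assign powers of two to the vertices of the given set. -/
def setupPowers : Prog :=
  .const rK 1;;
  forLt rU rN (fetchX rU;; ifEq rT 1 (.store 1 rU rK;; .add rK rK rK) .skip)

/-- Name the parts of the co-cluster graph by representatives. -/
def setupParts : Prog :=
  forLt rU rN ((.store 2 rU rN;; fetchX rU;; .const rOne 1);; .ite (.eq rT rOne) .skip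
    (forLt rV rN (fetchX rV;; ifEq rT 1 .skip (fetch rU rV;; ifEq rT 1 .skip (.store 2 rU rV)))))

/-- Compute the coloring of the given set that is described by the binary digits of `rC`. -/
def decode : Prog :=
  .copy rRem rC;;
  forLt rU rN (.const rOne 1;; .sub rV rN rU;; .sub rV rV rOne;; .const rCV 0;; .store 3 rV rCV;;
    fetchX rV;; ifEq rT 1 (.load rT 1 rV;; .ite (.lt rRem rT) (.const rCV 2;; .store 3 rV rCV)
      (.const rCV 1;; .store 3 rV rCV;; .sub rRem rRem rT)) .skip)

/-- Enter the initial state of the dynamic program. -/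
def initTable : Prog :=
  .copy rPtr rBase;;
  forLt rU rN (.load rCU 3 rU;;
    forLt rV rN (.load rCV 3 rV;; fetch rU rV;;
      ifEq rT 1 (.ite (.eq rCU rCV) (ifEq rCU 1 (.add rPtr rPtr rW)
        (ifEq rCU 2 (inc rPtr) .skip)) .skip) .skip));;
  .const rOne 1;; .store 4 rPtr rOne;; .const rSt 0;; .const rSt2 0

/-- Copy the ones in `rBL` consecutive cells of the table. -/
def block : Prog :=
  forLt rX rBL (.add rT rBS rX;; .load rT 4 rT;;
    ifEq rT 1 (.add rT rBD rX;; .store 4 rT rOne) .skip)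

/-- Compute the distances by which the states move when `rJ` gets colored. -/
def stepOffsets : Prog :=
  (.add rNew rBase rB;; .copy rSrc rBase;; .add rD1 rNew rQ;; .add rD2 rNew rSt;; .add rD2 rD2 rSt;;
    .copy rLim rSt;; inc rLim;; .copy rBL rR);;
  forLt rU rN (fetch rJ rU;; ifEq rT 1 (.load rCU 3 rU;; ifEq rCU 1 (.add rD1 rD1 rWW)
    (ifEq rCU 2 (inc rD2;; inc rD2) .skip)) .skip)

/-- Color the vertex `rJ`, in both ways. -/
def step : Prog :=
  stepOffsets;;
  forLt rRr rLim ((.copy rBS rSrc;; .copy rBD rD1);; block;; .copy rBD rD2;; block;;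
    .add rSrc rSrc rR;; .add rD1 rD1 rR;; .add rD1 rD1 rWW;; .add rD2 rD2 rR;;
    .const rOne 2;; .sub rD2 rD2 rOne);;
  .copy rBase rNew;; inc rSt2

/-- Finish a part. -/
def partEnd : Prog :=
  (.add rNew rBase rB;; .copy rSrc rBase;; .copy rD1 rNew;; .copy rLim rSt;; inc rLim;;
    .copy rBL rQ);;
  forLt rRr rLim (.copy rD2 rD1;;
    forLt rQq rNS ((.copy rBS rSrc;; .copy rBD rD2);; block;; .add rSrc rSrc rQ;;
      .add rD2 rD2 rR);;
    .add rD1 rD1 rR);;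
  .copy rBase rNew;; .copy rSt rSt2

/-- The dynamic program, for one coloring of the given set. -/
def table : Prog :=
  forLt rI rN (forLt rJ rN (.load rT 2 rJ;; .ite (.eq rT rI) step .skip);; partEnd)

/-- Look for a good state in the last layer of the table. -/
def scan : Prog :=
  .copy rSrc rBase;;
  forLt rRr rNS (.copy rPtr rSrc;;
    forLt rU rW (forLt rV rW (.load rT 4 rPtr;;
      ifEq rT 1 (.ite (.lt rU rK1) .skip (.ite (.lt rV rK2) .skip (.const 0 1))) .skip;;
      inc rPtr));;
    .add rSrc rSrc rR)

/-- The algorithm for a given vertex set whose deletion leaves a co-cluster graph. -/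
def solver : Prog :=
  setupRows;; setupTargets;; countPairs;; setupWeights;; setupPowers;; setupParts;;
  forLt rC rK (decode;; initTable;; table;; scan;; .add rBase rBase rB)

end Prog

/-! ### Reading the input and computing a modulator -/

/-- Adjacency as given by the input. -/
def Adj (M : ℕ → ℕ) (n u v : ℕ) : Prop := M (5 + u * n + v) = 1

/-- Membership in the set given with the input. -/
def InX (M : ℕ → ℕ) (n v : ℕ) : Prop := M (5 + n * n + v) = 1

instance (M : ℕ → ℕ) (n u v : ℕ) : Decidable (Adj M n u v) := by unfold Adj; infer_instance
instance (M : ℕ → ℕ) (n v : ℕ) : Decidable (InX M n v) := by unfold InX; infer_instance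

/-- The basic registers and the table of rows are set. -/
structure Loaded (M : ℕ → ℕ) (n : ℕ) (s : State) : Prop where
  arr0 : s.arr 0 = M
  num : s.reg rN = n
  xo : s.reg rXO = 5 + n * n
  row : ∀ u < n, s.arr 5 u = 5 + u * n

theorem Loaded.frame {M : ℕ → ℕ} {n : ℕ} {s s' : State} {p : Prog} (h : Loaded M n s)
    (hf : Frame p s s') (hr : rN ∉ p.regs ∧ rXO ∉ p.regs ∧ 0 ∉ p.arrs ∧ 5 ∉ p.arrs) :
    Loaded M n s' :=
  ⟨by rw [hf.arr 0 hr.2.2.1, h.arr0], by rw [hf.reg _ hr.1, h.num], by rw [hf.reg _ hr.2.1, h.xo],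
    by rw [hf.arr 5 hr.2.2.2]; exact h.row⟩

/-- Row offsets are accumulated by addition, since there is no multiplication. They start at 5, the
length of the header; the last value `5 + n * n` is where the indicator vector begins. -/
theorem setupRows_runs (s : State) :
    Runs .setupRows s (s.arr 0 0 * 5 + 5) (Loaded (s.arr 0) (s.arr 0 0)) := by
  unfold Prog.setupRows
  refine ((Runs.eval (T := 3) (Q := fun s' => s' =
    ((s.setReg rT 0).setReg rN (s.arr 0 0)).setReg rXO 5) rfl le_rfl
    (by simp [Prog.eval])).seq fun s3 _ h3 => ?_).weaken
    (T := 3 + (s.arr 0 0 * 5 + 2)) (by omega) (fun _ _ h => h)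
  have hn : s3.reg rN = s.arr 0 0 := by simp [h3]
  refine (Runs.forLt (T := 2) (I := fun k s' => s'.reg rXO = 5 + k * s.arr 0 0 ∧
    ∀ u < k, s'.arr 5 u = 5 + u * s.arr 0 0) (by decide) (by simp [h3]) ?_).weaken
    (by rw [hn]) ?_
  · intro k s' hk hf hi hI
    have hn' : s'.reg rN = s.arr 0 0 := by rw [hf.reg rN (by decide), hn]
    refine Runs.eval rfl (by decide) ?_
    simp only [Prog.eval, State.setReg_reg, State.setArr_reg, State.setReg_arr, State.setArr_arr]
    refine ⟨by simp [hI.1, hn']; ring, fun u hu => ?_⟩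
    simp only [if_true, hi, hI.1, Function.update_apply]
    split_ifs with h
    · rw [h]
    · exact hI.2 u (by omega)
  · intro s' hf h
    rw [hn] at h
    refine ⟨?_, ?_, h.1, h.2⟩
    · rw [hf.arr 0 (by decide)]; simp [h3]
    · rw [hf.reg rN (by decide), hn]

/-! ### Greedy packing of the forbidden triples -/

/-- Outside `X`, the vertices `u`, `v`, `w` induce an edge `uv` and an isolated vertex `w`. -/
def BadTriple (adj : ℕ → ℕ → Prop) (X : Finset ℕ) (u v w : ℕ) : Prop :=
  (u ∉ X ∧ v ∉ X ∧ w ∉ X) ∧ adj u v ∧ ¬ adj u w ∧ ¬ adj v w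

/-- `X` contains at most three times as many vertices as any set that meets all bad triples, and
this holds because of its intersection with such a set. -/
def IsPacked (adj : ℕ → ℕ → Prop) (n : ℕ) (X : Finset ℕ) : Prop :=
  (∀ v ∈ X, v < n) ∧ ∀ Y : Finset ℕ, (∀ u < n, ∀ v < n, ∀ w < n, ¬ BadTriple adj Y u v w) →
    X.card ≤ 3 * (X ∩ Y).card

/-- A hitting set `Y` contains a vertex of the triple, and this vertex is outside `X`. So `X ∩ Y`
gains at least one vertex while `X` gains at most three. -/
theorem IsPacked.addTriple {adj : ℕ → ℕ → Prop} {n : ℕ} {X : Finset ℕ} (h : IsPacked adj n X)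
    {u v w : ℕ} (hu : u < n) (hv : v < n) (hw : w < n) (hb : BadTriple adj X u v w) :
    IsPacked adj n (insert w (insert v (insert u X))) := by
  obtain ⟨⟨hu', hv', hw'⟩, hadj⟩ := hb
  refine ⟨?_, fun Y hY => ?_⟩
  · intro a ha
    simp only [Finset.mem_insert] at ha
    rcases ha with rfl | rfl | rfl | ha
    · exact hw
    · exact hv
    · exact hu
    · exact h.1 a ha
  · have h1 := h.2 Y hY
    have h2 : (insert w (insert v (insert u X))).card ≤ X.card + 3 := by
      have := Finset.card_insert_le w (insert v (insert u X))
      have := Finset.card_insert_le v (insert u X)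
      have := Finset.card_insert_le u X
      omega
    have h3 : ∃ a ∈ insert w (insert v (insert u X)), a ∈ Y ∧ a ∉ X := by
      by_contra hc
      push Not at hc
      refine hY u hu v hv w hw ⟨⟨fun h => hu' (hc u (by simp) h), fun h => hv' (hc v (by simp) h),
        fun h => hw' (hc w (by simp) h)⟩, hadj⟩
    obtain ⟨a, ha, haY, haX⟩ := h3
    have h4 : (Insert.insert a (X ∩ Y)).card ≤
        (insert w (insert v (insert u X)) ∩ Y).card := by
      refine Finset.card_le_card fun b hb => ?_
      simp only [Finset.mem_insert, Finset.mem_inter] at hb ha ⊢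
      rcases hb with rfl | hb
      · exact ⟨ha, haY⟩
      · exact ⟨by simp [hb.1], hb.2⟩
    rw [Finset.card_insert_of_notMem (by simp [haX])] at h4
    omega

/-- Enlarging the set never creates a bad triple, so a single pass over all triples suffices. -/
theorem BadTriple.anti {adj : ℕ → ℕ → Prop} {X X' : Finset ℕ} (h : X ⊆ X') {u v w : ℕ}
    (hb : BadTriple adj X' u v w) : BadTriple adj X u v w :=
  ⟨⟨fun h' => hb.1.1 (h h'), fun h' => hb.1.2.1 (h h'), fun h' => hb.1.2.2 (h h')⟩, hb.2⟩

/-- The input word with the indicator vector of `X`. -/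
def mark (M : ℕ → ℕ) (n : ℕ) (X : Finset ℕ) (i : ℕ) : ℕ :=
  if ∃ v ∈ X, i = 5 + n * n + v then 1 else M i

theorem mark_add {M : ℕ → ℕ} {n : ℕ} (hM : ∀ v, M (5 + n * n + v) = 0) (X : Finset ℕ) (v : ℕ) :
    mark M n X (5 + n * n + v) = if v ∈ X then 1 else 0 := by
  unfold mark
  rw [hM]
  congr 1
  simp

theorem mark_of_lt {M : ℕ → ℕ} {n : ℕ} (X : Finset ℕ) {i : ℕ} (hi : i < 5 + n * n) :
    mark M n X i = M i := by
  unfold mark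
  rw [if_neg]
  rintro ⟨v, -, h⟩
  omega

theorem mark_insert (M : ℕ → ℕ) (n : ℕ) (X : Finset ℕ) (v : ℕ) :
    mark M n (insert v X) = Function.update (mark M n X) (5 + n * n + v) 1 := by
  funext i
  simp only [mark, Function.update_apply]
  by_cases h : i = 5 + n * n + v
  · rw [if_pos ⟨v, Finset.mem_insert_self v X, h⟩, if_pos h]
  · rw [if_neg h]
    congr 1
    apply propext
    constructor
    · rintro ⟨u, hu, rfl⟩
      rcases Finset.mem_insert.mp hu with rfl | hu
      · exact absurd rfl h
      · exact ⟨u, hu, rfl⟩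
    · rintro ⟨u, hu, hi⟩
      exact ⟨u, Finset.mem_insert_of_mem hu, hi⟩

theorem row_lt {n u v : ℕ} (hu : u < n) (hv : v < n) : 5 + u * n + v < 5 + n * n := by
  nlinarith

theorem hitTriple_runs {M : ℕ → ℕ} {n : ℕ} (hM : ∀ v, M (5 + n * n + v) = 0) {X : Finset ℕ}
    {u v w : ℕ} (hX : IsPacked (Adj M n) n X) (hu : u < n) (hv : v < n) (hw : w < n) {s : State}
    (hs : Loaded (mark M n X) n s) (hsu : s.reg rU = u) (hsv : s.reg rV = v)
    (hsw : s.reg rZ = w) :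
    Runs .hitTriple s 40 (fun s' => ∃ X', IsPacked (Adj M n) n X' ∧ X ⊆ X' ∧
      s'.arr 0 = mark M n X' ∧ ¬ BadTriple (Adj M n) X' u v w) := by
  refine Runs.eval rfl (by decide) ?_
  -- The marks lie behind the adjacency matrix, so adjacency tests still read the original word.
  have e1 : mark M n X (5 + u * n + v) = M (5 + u * n + v) := mark_of_lt X (row_lt hu hv)
  have e2 : mark M n X (5 + u * n + w) = M (5 + u * n + w) := mark_of_lt X (row_lt hu hw)
  have e3 : mark M n X (5 + v * n + w) = M (5 + v * n + w) := mark_of_lt X (row_lt hv hw)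
  have hadj : ∀ a b, Adj M n a b ↔ M (5 + a * n + b) = 1 := fun _ _ => Iff.rfl
  by_cases hb : BadTriple (Adj M n) X u v w
  · refine ⟨_, hX.addTriple hu hv hw hb, fun a ha => by simp [ha], ?_, fun h => h.1.1 (by simp)⟩
    obtain ⟨⟨h1, h2, h3⟩, h4, h5, h6⟩ := hb
    rw [hadj] at h4 h5 h6
    simp [Prog.hitTriple, Prog.markTriple, Prog.fetchX, Prog.fetch, Prog.ifEq, Prog.eval,
      Test.holds, hs.arr0, hs.xo, hs.row u hu, hs.row v hv, hsu, hsv, hsw, mark_add hM, e1, e2, e3,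
      h1, h2, h3, h4, h5, h6]
    rw [mark_insert, mark_insert, mark_insert]
  · refine ⟨X, hX, subset_rfl, ?_, hb⟩
    simp only [BadTriple, hadj] at hb
    simp [Prog.hitTriple, Prog.markTriple, Prog.fetchX, Prog.fetch, Prog.ifEq, Prog.eval,
      Test.holds, hs.arr0, hs.xo, hs.row u hu, hs.row v hv, hsu, hsv, hsw, mark_add hM, e1, e2, e3]
    split_ifs <;> first | rfl | (simp [hs.arr0]; done) | (exfalso; apply hb; refine ⟨⟨?_, ?_, ?_⟩, ?_, ?_, ?_⟩ <;> assumption)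

theorem Loaded.frame_of_arr {M M' : ℕ → ℕ} {n : ℕ} {s s' : State} {p : Prog} (h : Loaded M n s)
    (hf : Frame p s s') (h0 : s'.arr 0 = M') (hr : rN ∉ p.regs ∧ rXO ∉ p.regs ∧ 5 ∉ p.arrs) :
    Loaded M' n s' :=
  ⟨h0, by rw [hf.reg _ hr.1, h.num], by rw [hf.reg _ hr.2.1, h.xo],
    by rw [hf.arr 5 hr.2.2]; exact h.row⟩

/-- The word in array `0` is the input word, marked with a packed set that hits all bad triples
described by `P`. -/
def GreedyInv (M : ℕ → ℕ) (n : ℕ) (P : ℕ → ℕ → ℕ → Prop) (s : State) : Prop :=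
  ∃ X, IsPacked (Adj M n) n X ∧ s.arr 0 = mark M n X ∧
    ∀ u < n, ∀ v < n, ∀ w < n, P u v w → ¬ BadTriple (Adj M n) X u v w

theorem GreedyInv.imp {M : ℕ → ℕ} {n : ℕ} {P P' : ℕ → ℕ → ℕ → Prop} {s s' : State}
    (h : GreedyInv M n P s) (hs : s'.arr 0 = s.arr 0)
    (hP : ∀ u < n, ∀ v < n, ∀ w < n, P' u v w → P u v w) : GreedyInv M n P' s' := by
  obtain ⟨X, h1, h2, h3⟩ := h
  exact ⟨X, h1, by rw [hs, h2], fun u hu v hv w hw hp => h3 u hu v hv w hw (hP u hu v hv w hw hp)⟩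

/-- At each nesting level the invariant says that the triples lexicographically before the current
one are hit. Zeros behind the matrix (`hM`) represent the empty starting set. -/
theorem greedy_runs {M : ℕ → ℕ} {n : ℕ} (hM : ∀ v, M (5 + n * n + v) = 0) {s : State}
    (hs : Loaded M n s) :
    Runs .greedy s (n * ((n * ((n * (40 + 3) + 2) + 3) + 2) + 3) + 2)
      (GreedyInv M n fun _ _ _ => True) := by
  have hinit : GreedyInv M n (fun _ _ _ => False) s :=
    ⟨∅, ⟨by simp, by simp⟩, by rw [hs.arr0]; funext i; simp [mark], by simp⟩
  unfold Prog.greedy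
  refine (Runs.forLt (T := n * ((n * (40 + 3) + 2) + 3) + 2)
    (I := fun k => GreedyInv M n fun u _ _ => u < k) (by decide)
    (hinit.imp (by simp) (by simp)) ?_).weaken (by rw [hs.num])
    (fun s' _ h => h.imp rfl fun u hu _ _ _ _ _ => by rwa [hs.num])
  intro k1 s1 hk1 hf1 hu1 hI1
  rw [hs.num] at hk1
  have hn1 : s1.reg rN = n := by rw [hf1.reg _ (by decide), hs.num]
  refine (Runs.forLt (T := n * (40 + 3) + 2)
    (I := fun k => GreedyInv M n fun u v _ => u < k1 ∨ (u = k1 ∧ v < k)) (by decide)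
    (hI1.imp (by simp) (by simp)) ?_).weaken (by rw [hn1])
    (fun s' _ h => h.imp (by simp) fun u hu v hv _ _ h' => by omega)
  intro k2 s2 hk2 hf2 hv2 hI2
  rw [hn1] at hk2
  have hn2 : s2.reg rN = n := by rw [hf2.reg _ (by decide), hn1]
  refine (Runs.forLt (T := 40)
    (I := fun k => GreedyInv M n fun u v w => u < k1 ∨ (u = k1 ∧ (v < k2 ∨ (v = k2 ∧ w < k))))
    (by decide) (hI2.imp (by simp) (by simp)) ?_).weaken (by rw [hn2])
    (fun s' _ h => h.imp (by simp) fun u hu v hv _ _ h' => by omega)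
  intro k3 s3 hk3 hf3 hw3 hI3
  rw [hn2] at hk3
  obtain ⟨X, hX, hX0, hX3⟩ := hI3
  -- Array `0` changes during the loops, so only its current content, taken from the invariant, is
  -- available here.
  have hL : Loaded (mark M n X) n s3 :=
    ⟨hX0, by rw [hf3.reg _ (by decide), hn2],
      by rw [hf3.reg _ (by decide), hf2.reg _ (by decide), hf1.reg _ (by decide), hs.xo],
      by rw [hf3.arr _ (by decide), hf2.arr _ (by decide), hf1.arr _ (by decide)]; exact hs.row⟩
  refine (hitTriple_runs hM hX hk1 hk2 hk3 hL
    (by rw [hf3.reg _ (by decide), hf2.reg _ (by decide), hu1])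
    (by rw [hf3.reg _ (by decide), hv2]) hw3).weaken le_rfl ?_
  rintro s4 - ⟨X', hX', hsub, h0, hb⟩
  refine ⟨X', hX', by simp [h0], fun u hu v hv w hw hp hbad => ?_⟩
  by_cases hc : u = k1 ∧ v = k2 ∧ w = k3
  · obtain ⟨rfl, rfl, rfl⟩ := hc
    exact hb hbad
  · exact hX3 u hu v hv w hw (by omega) (hbad.anti hsub)

/-! ### Preparations of the algorithm -/

/-- The number of ordered pairs of adjacent vertices. -/
def pairCount (M : ℕ → ℕ) (n : ℕ) : ℕ :=
  ∑ u ∈ Finset.range n, ∑ v ∈ Finset.range n, if Adj M n u v then 1 else 0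

/-- The weight of the number of red pairs in the code of a state. -/
def wE (M : ℕ → ℕ) (n : ℕ) : ℕ := 1 + pairCount M n

/-- The weight of the number of red vertices in the current part. -/
def wQ (M : ℕ → ℕ) (n : ℕ) : ℕ := wE M n * wE M n

/-- The weight of the number of red vertices in the finished parts. -/
def wR (M : ℕ → ℕ) (n : ℕ) : ℕ := (n + 1) * wQ M n

/-- A bound on the codes of the states. -/
def wB (M : ℕ → ℕ) (n : ℕ) : ℕ := (n + 1) * wR M n

/-- The last number below a bound with the property `p`, and `d` if there is none. -/
def lastSat (p : ℕ → Prop) [DecidablePred p] (d : ℕ) : ℕ → ℕ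
  | 0 => d
  | k + 1 => if p k then k else lastSat p d k

/-- The representative of the part that contains `u`; it is `n` for vertices of the given set. -/
def part (M : ℕ → ℕ) (n u : ℕ) : ℕ :=
  if InX M n u then n else lastSat (fun v => ¬ InX M n v ∧ ¬ Adj M n u v) n n

/-- All preparations are done. -/
structure Ready (M : ℕ → ℕ) (n : ℕ) (s : State) : Prop extends Loaded M n s where
  k1 : s.reg rK1 = 2 * M 1
  k2 : s.reg rK2 = 2 * M 3
  ns : s.reg rNS = n + 1
  w : s.reg rW = wE M n
  ww : s.reg rWW = 2 * wE M n
  q : s.reg rQ = wQ M n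
  r : s.reg rR = wR M n
  b : s.reg rB = wB M n
  k : s.reg rK = 2 ^ Nat.count (InX M n) n
  pow : ∀ v < n, InX M n v → s.arr 1 v = 2 ^ Nat.count (InX M n) v
  parts : ∀ v < n, s.arr 2 v = part M n v

/-- Precomputed data live in registers 1 to 11 and in arrays 0, 1, 2 and 5; the main loop writes
only outside of these. -/
theorem Ready.frame {M : ℕ → ℕ} {n : ℕ} {s s' : State} {p : Prog} (h : Ready M n s)
    (hf : Frame p s s') (hr : ∀ r ∈ p.regs, r = 0 ∨ 12 ≤ r) (ha : ∀ a ∈ p.arrs, a = 3 ∨ a = 4) :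
    Ready M n s' := by
  have hr' : ∀ r, 1 ≤ r → r < 12 → s'.reg r = s.reg r := fun r h1 h2 =>
    hf.reg r fun hc => by have := hr r hc; omega
  have ha' : ∀ a, a ≠ 3 → a ≠ 4 → s'.arr a = s.arr a := fun a h1 h2 =>
    hf.arr a fun hc => by have := ha a hc; omega
  constructor
  · exact ⟨by rw [ha' 0 (by decide) (by decide), h.arr0],
      by rw [hr' _ (by decide) (by decide), h.num], by rw [hr' _ (by decide) (by decide), h.xo],
      by rw [ha' 5 (by decide) (by decide)]; exact h.row⟩
  · rw [hr' _ (by decide) (by decide), h.k1]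
  · rw [hr' _ (by decide) (by decide), h.k2]
  · rw [hr' _ (by decide) (by decide), h.ns]
  · rw [hr' _ (by decide) (by decide), h.w]
  · rw [hr' _ (by decide) (by decide), h.ww]
  · rw [hr' _ (by decide) (by decide), h.q]
  · rw [hr' _ (by decide) (by decide), h.r]
  · rw [hr' _ (by decide) (by decide), h.b]
  · rw [hr' _ (by decide) (by decide), h.k]
  · rw [ha' 1 (by decide) (by decide)]; exact h.pow
  · rw [ha' 2 (by decide) (by decide)]; exact h.parts

/-- The targets are doubled because ordered pairs are counted. Cells 1 and 3 hold the positive parts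
of the targets; the negative parts are never read. `rW` starts at 1 so that counting pairs ends at
`wE`. -/
theorem setupTargets_runs {M : ℕ → ℕ} {n : ℕ} {s : State} (hs : Loaded M n s) :
    Runs .setupTargets s 12 (fun s' => s'.reg rK1 = 2 * M 1 ∧ s'.reg rK2 = 2 * M 3 ∧
      s'.reg rNS = n + 1 ∧ s'.reg 0 = 0 ∧ s'.reg rBase = 0 ∧ s'.reg rW = 1) := by
  refine Runs.eval rfl (by decide) ?_
  simp [Prog.setupTargets, Prog.inc, Prog.eval, hs.arr0, hs.num, two_mul]

theorem countPairs_runs {M : ℕ → ℕ} {n : ℕ} {s : State} (hs : Loaded M n s)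
    (hw : s.reg rW = 1) :
    Runs .countPairs s (n * (n * 10 + 5) + 2) (fun s' => s'.reg rW = wE M n) := by
  unfold Prog.countPairs
  refine (Runs.forLt (T := n * (7 + 3) + 2) (I := fun k s' => s'.reg rW =
    1 + ∑ u ∈ Finset.range k, ∑ v ∈ Finset.range n, if Adj M n u v then 1 else 0) (by decide)
    (by simp [hw]) ?_).weaken (by rw [hs.num]) (fun s' _ h => by rw [h, hs.num]; rfl)
  intro k1 s1 hk1 hf1 hu1 hI1
  have hL1 := hs.frame hf1 (by decide)
  refine (Runs.forLt (T := 7) (I := fun k s' => s'.reg rW =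
    1 + ∑ u ∈ Finset.range k1, ∑ v ∈ Finset.range n, (if Adj M n u v then 1 else 0) +
      ∑ v ∈ Finset.range k, if Adj M n k1 v then 1 else 0) (by decide)
    (by simp [hI1]) ?_).weaken (by rw [hL1.num])
    (fun s' _ h => by
      simp only [State.setReg_reg]
      rw [hL1.num] at h
      rw [Finset.sum_range_succ, ← add_assoc, ← h]; rfl)
  intro k2 s2 hk2 hf2 hv2 hI2
  have hL2 := hL1.frame hf2 (by decide)
  rw [hs.num] at hk1
  refine Runs.eval rfl (by decide) ?_
  have hu2 : s2.reg rU = k1 := by rw [hf2.reg _ (by decide), hu1]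
  rw [Finset.sum_range_succ, ← add_assoc, ← hI2]
  by_cases h : M (5 + k1 * n + k2) = 1 <;>
    simp [Prog.fetch, Prog.ifEq, Prog.eval, Prog.inc, Test.holds, hu2, hv2, hL2.row k1 hk1,
      hL2.arr0, Adj, h]

/-- Multiplication by repeated addition. -/
theorem addLoop_runs {i b r x : ℕ} (s : State) (hi : i ≠ r ∧ i ≠ b ∧ i ≠ rTmp ∧ i ≠ x)
    (hr : r ≠ b ∧ r ≠ rTmp ∧ r ≠ x) (hb : b ≠ rTmp) (hx : x ≠ rTmp) :
    Runs (.forLt i b (.add r r x)) s (s.reg b * 4 + 2)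
      (fun s' => s'.reg r = s.reg r + s.reg b * s.reg x) := by
  refine Runs.forLt (T := 1) (I := fun k s' => s'.reg r = s.reg r + k * s.reg x)
    (by simp [Prog.regs, hi.1, hi.2.1, hi.2.2.1, hr.1.symm, hb]) (by simp [hi.1.symm]) ?_
  intro k s' hk hf hik hI
  refine Runs.eval rfl le_rfl ?_
  have hx' : s'.reg x = s.reg x := hf.reg x (by
    simp [Prog.forLt, Prog.inc, Prog.regs, hi.2.2.2.symm, hr.2.2.symm, hx])
  simp only [Prog.eval, State.setReg_reg, hi.1.symm, hr.2.1, if_false, if_true, hI, hx']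
  ring

theorem setupWeights_runs {M : ℕ → ℕ} {n : ℕ} {s : State} (hw : s.reg rW = wE M n)
    (hns : s.reg rNS = n + 1) :
    Runs .setupWeights s (wE M n * 4 + n * 8 + 18) (fun s' => s'.reg rWW = 2 * wE M n ∧
      s'.reg rQ = wQ M n ∧ s'.reg rR = wR M n ∧ s'.reg rB = wB M n) := by
  refine Runs.weaken (T := 2 + ((wE M n * 4 + 2) + (1 + (((n + 1) * 4 + 2) +
    (1 + ((n + 1) * 4 + 2)))))) ?_ (by omega) (fun _ _ h => h)
  unfold Prog.setupWeights
  refine (Runs.eval (T := 2) (Q := fun s' => s'.reg rWW = 2 * wE M n ∧ s'.reg rQ = 0) rfl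
    (by decide) (by simp [Prog.eval, hw, two_mul])).seq fun s1 hf1 h1 => ?_
  have hw1 : s1.reg rW = wE M n := by rw [hf1.reg _ (by decide), hw]
  refine ((addLoop_runs s1 (by decide) (by decide) (by decide) (by decide)).weaken
    (by rw [hw1]) (fun _ _ h => h)).seq fun s2 hf2 h2 => ?_
  refine (Runs.eval (T := 1) (Q := fun s' => s'.reg rR = 0) rfl
    (by decide) (by simp [Prog.eval])).seq fun s3 hf3 h3 => ?_
  have hns3 : s3.reg rNS = n + 1 := by
    rw [hf3.reg _ (by decide), hf2.reg _ (by decide), hf1.reg _ (by decide), hns]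
  have hq3 : s3.reg rQ = wQ M n := by
    rw [hf3.reg _ (by decide), h2, h1.2, hw1, zero_add]; rfl
  refine ((addLoop_runs s3 (by decide) (by decide) (by decide) (by decide)).weaken
    (by rw [hns3]) (fun _ _ h => h)).seq fun s4 hf4 h4 => ?_
  refine (Runs.eval (T := 1) (Q := fun s' => s'.reg rB = 0) rfl
    (by decide) (by simp [Prog.eval])).seq fun s5 hf5 h5 => ?_
  have hns5 : s5.reg rNS = n + 1 := by
    rw [hf5.reg _ (by decide), hf4.reg _ (by decide), hns3]
  have hr5 : s5.reg rR = wR M n := by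
    rw [hf5.reg _ (by decide), h4, h3, hns3, hq3, zero_add]; rfl
  refine (addLoop_runs s5 (by decide) (by decide) (by decide) (by decide)).weaken
    (by rw [hns5]) (fun s6 hf6 h6 => ?_)
  refine ⟨?_, ?_, ?_, ?_⟩
  · rw [hf6.reg _ (by decide), hf5.reg _ (by decide), hf4.reg _ (by decide),
      hf3.reg _ (by decide), hf2.reg _ (by decide), h1.1]
  · rw [hf6.reg _ (by decide), hf5.reg _ (by decide), hf4.reg _ (by decide), hq3]
  · rw [hf6.reg _ (by decide), hr5]
  · rw [h6, h5, hns5, hr5, zero_add]; rfl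

/-- A vertex of the given set with `i` smaller members gets weight `2 ^ i`. So the colorings of the
set correspond to the numbers below `rK`, read in binary. -/
theorem setupPowers_runs {M : ℕ → ℕ} {n : ℕ} {s : State} (hs : Loaded M n s) :
    Runs .setupPowers s (n * 9 + 3) (fun s' => s'.reg rK = 2 ^ Nat.count (InX M n) n ∧
      ∀ v < n, InX M n v → s'.arr 1 v = 2 ^ Nat.count (InX M n) v) := by
  unfold Prog.setupPowers
  refine ((Runs.eval (T := 1) (Q := fun s' => s'.reg rK = 1) rfl
    (by decide) (by simp [Prog.eval])).seq fun s1 hf1 h1 => ?_).weaken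
    (T := 1 + (n * (6 + 3) + 2)) (by omega) (fun _ _ h => h)
  have hL1 := hs.frame hf1 (by decide)
  refine (Runs.forLt (T := 6) (I := fun k s' => s'.reg rK = 2 ^ Nat.count (InX M n) k ∧
      ∀ v < k, InX M n v → s'.arr 1 v = 2 ^ Nat.count (InX M n) v) (by decide)
    (by simp [h1]) ?_).weaken (by rw [hL1.num]) (fun s' _ h => by rwa [hL1.num] at h)
  intro k s2 hk hf2 hu2 hI2
  have hL2 := hL1.frame_of_arr hf2 (by rw [hf2.arr 0 (by decide), hL1.arr0]) (by decide)
  refine Runs.eval rfl (by decide) ?_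
  by_cases h : InX M n k
  · have h' := h
    unfold InX at h'
    simp only [Prog.fetchX, Prog.ifEq, Prog.eval, Test.holds, hu2, hL2.xo, hL2.arr0,
      State.setReg_reg, State.setReg_arr, State.setArr_arr, State.setArr_reg, h', if_true, if_false,
      Nat.count_succ, h, Nat.reduceEqDiff]
    refine ⟨by simp [hI2.1, pow_succ]; ring, fun v hv hXv => ?_⟩
    rw [Function.update_apply]
    split_ifs with hvk
    · subst hvk; simp [hI2.1]
    · exact hI2.2 v (by omega) hXv
  · have h' := h
    unfold InX at h'
    simp only [Prog.fetchX, Prog.ifEq, Prog.eval, Test.holds, hu2, hL2.xo, hL2.arr0,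
      State.setReg_reg, State.setReg_arr, State.setArr_reg, h', if_true, if_false,
      Nat.count_succ, h, Nat.reduceEqDiff]
    refine ⟨by simp [hI2.1], fun v hv hXv => ?_⟩
    have hvk : v ≠ k := fun hc => h (hc ▸ hXv)
    exact hI2.2 v (by omega) hXv

/-- Each later non-neighbor overwrites the entry, so the last one remains; this is `lastSat`.
Vertices of the given set keep the value `n`, which is no part index of the main loop. -/
theorem setupParts_runs {M : ℕ → ℕ} {n : ℕ} {s : State} (hs : Loaded M n s) :
    Runs .setupParts s (n * (n * 13 + 10) + 2) (fun s' => ∀ v < n, s'.arr 2 v = part M n v) := by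
  unfold Prog.setupParts
  refine (Runs.forLt (T := 4 + ((n * (10 + 3) + 2) + 1))
    (I := fun k s' => ∀ v < k, s'.arr 2 v = part M n v) (by decide)
    (by simp) ?_).weaken (by rw [hs.num]; nlinarith) (fun s' _ h => by rwa [hs.num] at h)
  intro k1 s1 hk1 hf1 hu1 hI1
  rw [hs.num] at hk1
  have hL1 := hs.frame hf1 (by decide)
  refine (Runs.eval (T := 4) (Q := fun s' => s'.reg rT = M (5 + n * n + k1) ∧ s'.reg rOne = 1 ∧
    s'.arr 2 = Function.update (s1.arr 2) k1 n) rfl (by decide)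
    (by simp [Prog.eval, Prog.fetchX, hL1.arr0, hL1.num, hL1.xo, hu1])).seq fun s2 hf2 h2 => ?_
  have hL2 := hL1.frame hf2 (by decide)
  have hu2 : s2.reg rU = k1 := by rw [hf2.reg _ (by decide), hu1]
  refine Runs.ite (fun hb => Runs.eval rfl (by simp [Prog.cost]) ?_) (fun hb => ?_)
  · have hX : InX M n k1 := by
      simpa [Test.holds, h2.1, h2.2.1, InX] using hb
    simp only [Prog.eval, State.setReg_arr, h2.2.2, Function.update_apply]
    intro v hv
    split_ifs with hvk
    · rw [hvk, part, if_pos hX]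
    · exact hI1 v (by omega)
  · have hX : ¬ InX M n k1 := by
      simpa [Test.holds, h2.1, h2.2.1, InX] using hb
    refine (Runs.forLt (T := 10)
      (I := fun k s' => s'.arr 2 = Function.update (s1.arr 2) k1
        (lastSat (fun v => ¬ InX M n v ∧ ¬ Adj M n k1 v) n k)) (by decide)
      (by simp [h2, lastSat]) ?_).weaken (by rw [hL2.num]) ?_
    · intro k2 s3 hk2 hf3 hv3 hI3
      have hL3 := hL2.frame hf3 (by decide)
      have hu3 : s3.reg rU = k1 := by rw [hf3.reg _ (by decide), hu2]
      refine Runs.eval rfl (by decide) ?_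
      by_cases h : InX M n k2 <;> by_cases h2 : Adj M n k1 k2 <;>
      · have h' := h
        unfold InX at h'
        have h2' := h2
        unfold Adj at h2'
        simp [Prog.fetchX, Prog.fetch, Prog.ifEq, Prog.eval, Test.holds, hu3, hv3, hL3.xo, hL3.arr0,
          hL3.row k1 hk1, h', h2', h, h2, lastSat, hI3]
    · intro s3 _ h3
      rw [hL2.num] at h3
      simp only [State.setReg_arr, h3, Function.update_apply]
      intro v hv
      split_ifs with hvk
      · rw [hvk, part, if_neg hX]
      · exact hI1 v (by omega)

/-! ### The main loop -/

/-- The coloring of the given set that is described by the binary digits of `c`. -/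
def colOf (M : ℕ → ℕ) (n c v : ℕ) : ℕ :=
  if InX M n v then (if c.testBit (Nat.count (InX M n) v) then 1 else 2) else 0

theorem mod_two_pow_succ (c i : ℕ) :
    c % 2 ^ (i + 1) = c % 2 ^ i + if c.testBit i then 2 ^ i else 0 := by
  rw [pow_succ, Nat.mod_mul, Nat.testBit_eq_decide_div_mod_eq]
  rcases Nat.mod_two_eq_zero_or_one (c / 2 ^ i) with h | h <;> simp [h]

/-- Binary digits are extracted from the top by comparison and subtraction: once the vertices from
`v` on are treated, the remainder is `c` modulo `2` to the rank of `v`, so the next lower digit is 1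
exactly if the remainder is not below its power. -/
theorem decode_runs {M : ℕ → ℕ} {n c : ℕ} {s : State} (hs : Ready M n s) (hc : s.reg rC = c)
    (hcK : c < 2 ^ Nat.count (InX M n) n) :
    Runs .decode s (n * 18 + 3) (fun s' => ∀ v < n, s'.arr 3 v = colOf M n c v) := by
  unfold Prog.decode
  refine ((Runs.eval (T := 1) (Q := fun s' => s'.reg rRem = c) rfl
    (by decide) (by simp [Prog.eval, hc])).seq fun s1 hf1 h1 => ?_).weaken
    (T := 1 + (n * (15 + 3) + 2)) (by omega) (fun _ _ h => h)
  have hR1 := hs.frame hf1 (by decide) (by decide)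
  refine (Runs.forLt (T := 15) (I := fun k s' => s'.reg rRem = c % 2 ^ Nat.count (InX M n) (n - k) ∧
      ∀ v < n, n - k ≤ v → s'.arr 3 v = colOf M n c v) (by decide)
    ⟨by simp [h1, Nat.mod_eq_of_lt hcK], fun v hv hv' => by omega⟩ ?_).weaken (by rw [hR1.num])
    (fun s' _ h v hv => h.2 v hv (by rw [hR1.num]; omega))
  intro k s2 hk hf2 hu2 hI2
  rw [hR1.num] at hk
  have hR2 := hR1.frame hf2 (by decide) (by decide)
  -- Round `k` treats the vertex `v = n - 1 - k`; additive form avoids truncated subtraction.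
  obtain ⟨v, hv⟩ : ∃ v, n = v + 1 + k := ⟨n - k - 1, by omega⟩
  have hnk : n - k = v + 1 := by omega
  have hnk' : n - (k + 1) = v := by omega
  have hvk : n - k - 1 = v := by omega
  rw [hnk] at hI2
  simp only [hnk']
  have hval : ∀ u < n, v ≤ u → ∀ D : ℕ → ℕ, D v = colOf M n c v →
      (∀ w, w ≠ v → D w = s2.arr 3 w) → D u = colOf M n c u := by
    intro u hu hvu D hD hD'
    by_cases huv : u = v
    · rw [huv, hD]
    · rw [hD' u huv, hI2.2 u hu (by omega)]
  refine Runs.eval rfl (by decide) ?_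
  by_cases h : InX M n v
  · have h' := h
    unfold InX at h'
    have hpow := hR2.pow v (by omega) h
    have hmod := mod_two_pow_succ c (Nat.count (InX M n) v)
    have hlt : c % 2 ^ Nat.count (InX M n) v < 2 ^ Nat.count (InX M n) v :=
      Nat.mod_lt _ (by positivity)
    rw [Nat.count_succ, if_pos h, hmod] at hI2
    by_cases hb : c.testBit (Nat.count (InX M n) v)
    · have hcol : colOf M n c v = 1 := by simp [colOf, h, hb]
      simp [Prog.fetchX, Prog.ifEq, Prog.eval, Test.holds, hu2, hR2.xo, hR2.arr0, hR2.num, hvk, h',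
        hpow, hI2.1, hb]
      intro u hu hvu
      exact hval u hu hvu _ (by simp [hcol]) (fun w hw => by simp [hw])
    · have hcol : colOf M n c v = 2 := by simp [colOf, h, hb]
      simp [Prog.fetchX, Prog.ifEq, Prog.eval, Test.holds, hu2, hR2.xo, hR2.arr0, hR2.num, hvk, h',
        hpow, hI2.1, hb, hlt]
      intro u hu hvu
      exact hval u hu hvu _ (by simp [hcol]) (fun w hw => by simp [hw])
  · have h' := h
    unfold InX at h'
    have hcol : colOf M n c v = 0 := by simp [colOf, h]
    rw [Nat.count_succ, if_neg h] at hI2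
    simp [Prog.fetchX, Prog.ifEq, Prog.eval, Test.holds, hu2, hR2.xo, hR2.arr0, hR2.num, hvk, h',
      hI2.1]
    intro u hu hvu
    exact hval u hu hvu _ (by simp [hcol]) (fun w hw => by simp [hw])

/-- The contribution of an ordered pair of vertices to the code of the initial state. -/
def pairCode (M : ℕ → ℕ) (n : ℕ) (col : ℕ → ℕ) (u v : ℕ) : ℕ :=
  if Adj M n u v ∧ col u = col v then
    if col u = 1 then wE M n else if col u = 2 then 1 else 0
  else 0

/-- Initially `r = q = 0`. The pointer moves by `wE` for each red pair inside the given set and by 1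
for each blue pair, which leads it to the cell of the initial code. -/
theorem initTable_runs {M : ℕ → ℕ} {n base : ℕ} {col : ℕ → ℕ} {s : State} (hs : Ready M n s)
    (hcol : ∀ v < n, s.arr 3 v = col v) (hbase : s.reg rBase = base) :
    Runs .initTable s (n * (n * 16 + 6) + 7) (fun s' => s'.reg rSt = 0 ∧ s'.reg rSt2 = 0 ∧
      s'.arr 4 = Function.update (s.arr 4) (base + ∑ u ∈ Finset.range n, ∑ v ∈ Finset.range n,
        pairCode M n col u v) 1) := by
  unfold Prog.initTable
  refine ((Runs.eval (T := 1) (Q := fun s' => s'.reg rPtr = base) rfl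
    (by decide) (by simp [Prog.eval, hbase])).seq fun s1 hf1 h1 => ?_).weaken
    (T := 1 + ((n * ((1 + (n * (13 + 3) + 2)) + 3) + 2) + 4)) (by ring_nf; omega) (fun _ _ h => h)
  have hR1 := hs.frame hf1 (by decide) (by decide)
  refine Runs.seq (R := fun s' => s'.reg rPtr = base + ∑ u ∈ Finset.range n,
    ∑ v ∈ Finset.range n, pairCode M n col u v) ?_ fun s2 hf2 h2 => Runs.eval rfl (by decide) (by
      simp [Prog.eval, h2, hf2.arr 4 (by decide), hf1.arr 4 (by decide)])
  refine (Runs.forLt (T := 1 + (n * (13 + 3) + 2)) (I := fun k s' => s'.reg rPtr =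
    base + ∑ u ∈ Finset.range k, ∑ v ∈ Finset.range n, pairCode M n col u v) (by decide)
    (by simp [h1]) ?_).weaken (by rw [hR1.num]) (fun s' _ h => by rwa [hR1.num] at h)
  intro k1 s2 hk1 hf2 hu2 hI2
  rw [hR1.num] at hk1
  have hR2 := hR1.frame hf2 (by decide) (by decide)
  refine (Runs.eval (T := 1) (Q := fun s' => s'.reg rCU = col k1) rfl
    (by decide) (by
      simp [Prog.eval, hu2, hf2.arr 3 (by decide), hf1.arr 3 (by decide), hcol k1 hk1])).seq
    fun s3 hf3 h3 => ?_
  have hR3 := hR2.frame hf3 (by decide) (by decide)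
  refine (Runs.forLt (T := 13) (I := fun k s' => s'.reg rPtr =
    base + ∑ u ∈ Finset.range k1, ∑ v ∈ Finset.range n, pairCode M n col u v +
      ∑ v ∈ Finset.range k, pairCode M n col k1 v) (by decide)
    (by simp [hf3.reg _ (by decide : rPtr ∉ _), hI2]) ?_).weaken (by rw [hR3.num]) (fun s' _ h => by
      rw [hR3.num] at h
      simp only [State.setReg_reg]
      rw [Finset.sum_range_succ, ← add_assoc, ← h]; rfl)
  intro k2 s4 hk2 hf4 hv4 hI4
  rw [hR3.num] at hk2
  have hR4 := hR3.frame hf4 (by decide) (by decide)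
  have hu4 : s4.reg rU = k1 := by rw [hf4.reg _ (by decide), hf3.reg _ (by decide), hu2]
  have hcu4 : s4.reg rCU = col k1 := by rw [hf4.reg _ (by decide), h3]
  have hcv4 : s4.arr 3 k2 = col k2 := by
    rw [hf4.arr 3 (by decide), hf3.arr 3 (by decide), hf2.arr 3 (by decide),
      hf1.arr 3 (by decide), hcol k2 hk2]
  refine Runs.eval rfl (by decide) ?_
  rw [Finset.sum_range_succ, ← add_assoc, ← hI4, pairCode]
  unfold Adj
  by_cases h : M (5 + k1 * n + k2) = 1 <;> by_cases hc : col k1 = col k2 <;>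
    by_cases h1 : col k1 = 1 <;> by_cases h2 : col k1 = 2 <;>
    simp_all [Prog.fetch, Prog.ifEq, Prog.eval, Prog.inc, Test.holds, hR4.row k1 hk1,
      hR4.arr0, hR4.w]

/-! ### Layers of the table as sets of codes -/

/-- The cell `a` of a layer shows whether `a` belongs to `T`. -/
def Cell (D : ℕ → ℕ) (base : ℕ) (T : Set ℕ) (a : ℕ) : Prop :=
  (a ∈ T → D (base + a) = 1) ∧ (a ∉ T → D (base + a) = 0)

/-- Two consecutive layers of the table show the sets `T` and `U`. -/
def Layers (D : ℕ → ℕ) (base B : ℕ) (T U : Set ℕ) : Prop :=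
  (∀ a < B, Cell D base T a) ∧ ∀ a, Cell D (base + B) U a

/-- All cells behind a layer are zero, so the next layer is written on fresh memory and nothing is
ever cleared. -/
theorem Layers.of_cell {D : ℕ → ℕ} {base B : ℕ} {T : Set ℕ} (h : ∀ a, Cell D base T a)
    (hT : ∀ a ∈ T, a < B) : Layers D base B T ∅ := by
  refine ⟨fun a _ => h a, fun a => ⟨fun ha => ha.elim, fun _ => ?_⟩⟩
  rw [add_assoc]
  exact (h (B + a)).2 fun hc => by have := hT _ hc; omega

theorem Layers.congr {D : ℕ → ℕ} {base B : ℕ} {T U U' : Set ℕ} (h : Layers D base B T U)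
    (hU : ∀ a, a ∈ U ↔ a ∈ U') : Layers D base B T U' := by
  rwa [← Set.ext hU]

/-- Destinations lie in the upper layer, so the source `T` is not disturbed. Only ones are written,
so successive copies accumulate as unions. -/
theorem block_runs {base B σ δ L : ℕ} {T U : Set ℕ} {s : State}
    (hs : Layers (s.arr 4) base B T U) (h1 : s.reg rBS = base + σ)
    (h2 : s.reg rBD = base + B + δ) (h3 : s.reg rBL = L) (hL : σ + L ≤ B) :
    Runs .block s (L * 9 + 2) (fun s' => Layers (s'.arr 4) base B T
      (U ∪ {b | ∃ x < L, σ + x ∈ T ∧ b = δ + x})) := by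
  unfold Prog.block
  refine (Runs.forLt (T := 6) (I := fun k s' => Layers (s'.arr 4) base B T
    (U ∪ {b | ∃ x < k, σ + x ∈ T ∧ b = δ + x})) (by decide)
    (by simpa using hs) ?_).weaken (by rw [h3]) (fun s' _ h => by rwa [h3] at h)
  intro k s1 hk hf1 hx1 hI1
  have e1 : s1.reg rBS = base + σ := by rw [hf1.reg _ (by decide), h1]
  have e2 : s1.reg rBD = base + B + δ := by rw [hf1.reg _ (by decide), h2]
  refine Runs.eval rfl (by decide) ?_
  have hcell := hI1.1 (σ + k) (by omega)
  rw [Cell, ← add_assoc] at hcell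
  by_cases h : σ + k ∈ T
  · simp only [Prog.ifEq, Prog.eval, Test.holds, State.setReg_reg, State.setReg_arr,
      State.setArr_arr, e1, e2, hx1, hcell.1 h, if_true, if_false,
      Nat.reduceEqDiff]
    refine ⟨fun a ha => ?_, fun a => ?_⟩
    · have hne : base + a ≠ base + B + δ + k := by omega
      simpa only [Cell, Function.update_apply, hne, if_false] using hI1.1 a ha
    · have hold := hI1.2 a
      by_cases hak : a = δ + k
      · subst hak
        refine ⟨fun _ => by simp [add_assoc], fun hc => ?_⟩
        exact absurd (Or.inr ⟨k, by omega, h, rfl⟩) hc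
      · have hne : base + B + a ≠ base + B + δ + k := by omega
        simp only [Cell, Function.update_apply, hne, if_false] at hold ⊢
        have hiff : (a ∈ U ∪ {b | ∃ x < k + 1, σ + x ∈ T ∧ b = δ + x}) ↔
            a ∈ U ∪ {b | ∃ x < k, σ + x ∈ T ∧ b = δ + x} := by
          simp only [Set.mem_union, Set.mem_ofPred_eq]
          refine or_congr Iff.rfl ⟨?_, ?_⟩
          · rintro ⟨x, hx, hxT, rfl⟩
            exact ⟨x, by omega, hxT, rfl⟩
          · rintro ⟨x, hx, hxT, rfl⟩
            exact ⟨x, by omega, hxT, rfl⟩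
        rwa [hiff]
  · simp only [Prog.ifEq, Prog.eval, Test.holds, State.setReg_reg, State.setReg_arr,
      e1, hx1, hcell.2 h, if_true, if_false, Nat.reduceEqDiff, zero_ne_one]
    refine hI1.congr fun a => ?_
    simp only [Set.mem_union, Set.mem_ofPred_eq]
    refine or_congr Iff.rfl ⟨?_, ?_⟩
    · rintro ⟨x, hx, hxT, rfl⟩
      exact ⟨x, by omega, hxT, rfl⟩
    · rintro ⟨x, hx, hxT, rfl⟩
      rcases Nat.lt_succ_iff_lt_or_eq.mp hx with hx | rfl
      · exact ⟨x, hx, hxT, rfl⟩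
      · exact absurd hxT h

/-- The number of neighbors of `j` that have color `k` in the coloring of the given set. -/
def nbrCount (M : ℕ → ℕ) (n : ℕ) (col : ℕ → ℕ) (k j : ℕ) : ℕ :=
  ∑ u ∈ Finset.range n, if Adj M n j u ∧ col u = k then 1 else 0

/-- These are the offsets for `r = 0`. A red vertex adds `wQ` for itself and `2 * wE` for each red
neighbor in the given set; a blue one adds 2 for each blue neighbor there and for each of the `st`
finished vertices, which are all blue. -/
theorem stepOffsets_runs {M : ℕ → ℕ} {n base st j : ℕ} {col : ℕ → ℕ} {s : State}
    (hs : Ready M n s) (hcol : ∀ v < n, s.arr 3 v = col v) (hbase : s.reg rBase = base)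
    (hst : s.reg rSt = st) (hj : s.reg rJ = j) (hjn : j < n) :
    Runs .stepOffsets s (n * 17 + 11) (fun s' => s'.reg rNew = base + wB M n ∧
      s'.reg rSrc = base ∧ s'.reg rD1 = base + wB M n + (wQ M n + 2 * wE M n * nbrCount M n col 1 j) ∧
      s'.reg rD2 = base + wB M n + 2 * (nbrCount M n col 2 j + st) ∧ s'.reg rLim = st + 1 ∧
      s'.reg rBL = wR M n) := by
  unfold Prog.stepOffsets
  refine ((Runs.eval (T := 9) (Q := fun s' => s'.reg rNew = base + wB M n ∧
      s'.reg rSrc = base ∧ s'.reg rD1 = base + wB M n + wQ M n ∧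
      s'.reg rD2 = base + wB M n + 2 * st ∧ s'.reg rLim = st + 1 ∧
      s'.reg rBL = wR M n) rfl (by decide)
    (by simp [Prog.eval, Prog.inc, hbase, hst, hs.b, hs.q, hs.r]; omega)).seq
    fun s1 hf1 h1 => ?_).weaken (T := 9 + (n * (14 + 3) + 2)) (by omega) (fun _ _ h => h)
  have hR1 := hs.frame hf1 (by decide) (by decide)
  refine (Runs.forLt (T := 14) (I := fun k s' =>
    s'.reg rD1 = base + wB M n + (wQ M n + 2 * wE M n *
      ∑ u ∈ Finset.range k, if Adj M n j u ∧ col u = 1 then 1 else 0) ∧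
    s'.reg rD2 = base + wB M n + 2 * ((∑ u ∈ Finset.range k,
      if Adj M n j u ∧ col u = 2 then 1 else 0) + st)) (by decide)
    (by simp [h1, add_assoc]) ?_).weaken (by rw [hR1.num]) (fun s2 hf2 h => ?_)
  · intro k s2 hk hf2 hu2 hI2
    rw [hR1.num] at hk
    have hR2 := hR1.frame hf2 (by decide) (by decide)
    have hj2 : s2.reg rJ = j := by rw [hf2.reg _ (by decide), hf1.reg _ (by decide), hj]
    have hc2 : s2.arr 3 k = col k := by
      rw [hf2.arr 3 (by decide), hf1.arr 3 (by decide), hcol k hk]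
    refine Runs.eval rfl (by decide) ?_
    simp only [Finset.sum_range_succ]
    by_cases h : M (5 + j * n + k) = 1 <;> by_cases h1 : col k = 1 <;> by_cases h2 : col k = 2 <;>
      first
      | omega
      | (simp [Prog.fetch, Prog.ifEq, Prog.eval, Prog.inc, Test.holds, hu2, hj2, hc2,
          hR2.row j hjn, hR2.arr0, hR2.ww, h, h1, h2, hI2, Adj, -Finset.sum_boole]; try ring_nf)
  · rw [hR1.num] at h
    refine ⟨?_, ?_, h.1, h.2, ?_, ?_⟩
    · rw [hf2.reg _ (by decide), h1.1]
    · rw [hf2.reg _ (by decide), h1.2.1]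
    · rw [hf2.reg _ (by decide), h1.2.2.2.2.1]
    · rw [hf2.reg _ (by decide), h1.2.2.2.2.2]

/-- The codes of the states after coloring a vertex, where `st` vertices lie in finished parts and
the vertex has `nr` red and `nb` blue neighbors in the given set. -/
def stepSet (M : ℕ → ℕ) (n st nr nb : ℕ) (T : Set ℕ) : Set ℕ :=
  {b | ∃ r < st + 1, ∃ x < wR M n, r * wR M n + x ∈ T ∧
    (b = r * wR M n + (wQ M n + 2 * wE M n * (nr + r)) + x ∨
      b = r * wR M n + 2 * (nb + (st - r)) + x)}

/-- Both offsets depend only on `r`, so each row of `wR` cells is copied twice as a whole. From `r`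
to `r + 1` the destinations move by one row, plus `2 * wE` for red and minus 2 for blue. -/
theorem step_runs {M : ℕ → ℕ} {n base st j : ℕ} {col : ℕ → ℕ} {T : Set ℕ} {s : State}
    (hs : Ready M n s) (hcol : ∀ v < n, s.arr 3 v = col v) (hbase : s.reg rBase = base)
    (hst : s.reg rSt = st) (hj : s.reg rJ = j) (hjn : j < n) (hstn : st ≤ n)
    (hT : ∀ a, Cell (s.arr 4) base T a) (hTB : ∀ a ∈ T, a < wB M n) :
    Runs .step s (n * 17 + 11 + ((st + 1) * (wR M n * 18 + 16) + 2) + 3)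
      (fun s' => s'.reg rBase = base + wB M n ∧ s'.reg rSt2 = s.reg rSt2 + 1 ∧
        ∀ a, Cell (s'.arr 4) (base + wB M n)
          (stepSet M n st (nbrCount M n col 1 j) (nbrCount M n col 2 j) T) a) := by
  unfold Prog.step
  set nr := nbrCount M n col 1 j with hnr
  set nb := nbrCount M n col 2 j with hnb
  refine Runs.weaken (T := (n * 17 + 11) + (((st + 1) * ((2 + ((wR M n * 9 + 2) + (1 +
    ((wR M n * 9 + 2) + 6)))) + 3) + 2) + 3)) ?_ (by ring_nf; omega) (fun _ _ h => h)
  refine (stepOffsets_runs hs hcol hbase hst hj hjn).seq fun s1 hf1 h1 => ?_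
  obtain ⟨hnew1, hsrc1, hd1, hd2, hlim, hbl⟩ := h1
  rw [← hnr] at hd1
  rw [← hnb] at hd2
  have hR1 := hs.frame hf1 (by decide) (by decide)
  refine Runs.seq (R := fun s' => Layers (s'.arr 4) base (wB M n) T (stepSet M n st nr nb T)) ?_
    fun s2 hf2 h2 => Runs.eval rfl (by decide) ?_
  swap
  · simp [Prog.eval, Prog.inc, hf2.reg rNew (by decide), hnew1, hf2.reg rSt2 (by decide),
      hf1.reg rSt2 (by decide), h2.2]
  -- The value of `rD2` is claimed only while `k ≤ st`: after the last round the register has been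
  -- decreased once more, whereas `st - k` is truncated at 0.
  refine (Runs.forLt (T := 2 + ((wR M n * 9 + 2) + (1 + ((wR M n * 9 + 2) + 6))))
    (I := fun k s' => s'.reg rSrc = base + k * wR M n ∧
      s'.reg rD1 = base + wB M n + (k * wR M n + (wQ M n + 2 * wE M n * (nr + k))) ∧
      (k < st + 1 → s'.reg rD2 = base + wB M n + (k * wR M n + 2 * (nb + (st - k)))) ∧
      Layers (s'.arr 4) base (wB M n) T {b | ∃ r < k, ∃ x < wR M n, r * wR M n + x ∈ T ∧
        (b = r * wR M n + (wQ M n + 2 * wE M n * (nr + r)) + x ∨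
          b = r * wR M n + 2 * (nb + (st - r)) + x)}) (by decide) ?_ ?_).weaken (by rw [hlim])
      (fun s' _ h => by rw [hlim] at h; exact h.2.2.2)
  · refine ⟨by simp [hsrc1], by simp [hd1], fun _ => by simp [hd2], ?_⟩
    refine (Layers.of_cell (D := s1.arr 4) (fun a => ?_) hTB).congr (by simp)
    rw [hf1.arr 4 (by decide)]; exact hT a
  intro k s2 hk hf2 hr2 hI2
  rw [hlim] at hk
  have hR2 := hR1.frame hf2 (by decide) (by decide)
  obtain ⟨hsrc2, hd12, hd22, hlay⟩ := hI2
  have hd22 := hd22 hk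
  have hkB : k * wR M n + wR M n ≤ wB M n := by
    have : k + 1 ≤ n + 1 := by omega
    calc k * wR M n + wR M n = (k + 1) * wR M n := by ring
      _ ≤ wB M n := Nat.mul_le_mul_right _ this
  have hbl2 : s2.reg rBL = wR M n := by rw [hf2.reg _ (by decide), hbl]
  refine (Runs.eval (T := 2) (Q := fun s' => s'.reg rBS = base + k * wR M n ∧ s'.reg rBD = base +
    wB M n + (k * wR M n + (wQ M n + 2 * wE M n * (nr + k))) ∧ s'.arr 4 = s2.arr 4) rfl (by decide)
    (by simp [Prog.eval, hsrc2, hd12])).seq fun s3 hf3 h3 => ?_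
  refine (block_runs (L := wR M n) (by rw [h3.2.2]; exact hlay) h3.1 h3.2.1
    (by rw [hf3.reg _ (by decide), hbl2]) hkB).seq fun s4 hf4 h4 => ?_
  refine (Runs.eval (T := 1) (Q := fun s' => s'.reg rBD = base +
    wB M n + (k * wR M n + 2 * (nb + (st - k))) ∧ s'.arr 4 = s4.arr 4) rfl (by decide)
    (by simp [Prog.eval, hf4.reg rD2 (by decide), hf3.reg rD2 (by decide), hd22])).seq
      fun s5 hf5 h5 => ?_
  refine (block_runs (L := wR M n) (by rw [h5.2]; exact h4)
    (by rw [hf5.reg _ (by decide), hf4.reg _ (by decide), h3.1]) h5.1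
    (by rw [hf5.reg _ (by decide), hf4.reg _ (by decide), hf3.reg _ (by decide), hbl2]) hkB).seq
      fun s6 hf6 h6 => ?_
  have eR : s6.reg rR = wR M n := by
    rw [hf6.reg _ (by decide), hf5.reg _ (by decide), hf4.reg _ (by decide),
      hf3.reg _ (by decide), hR2.r]
  have eW : s6.reg rWW = 2 * wE M n := by
    rw [hf6.reg _ (by decide), hf5.reg _ (by decide), hf4.reg _ (by decide),
      hf3.reg _ (by decide), hR2.ww]
  have eS : s6.reg rSrc = base + k * wR M n := by
    rw [hf6.reg _ (by decide), hf5.reg _ (by decide), hf4.reg _ (by decide),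
      hf3.reg _ (by decide), hsrc2]
  have e1 := hf6.reg rD1 (by decide)
  rw [hf5.reg _ (by decide), hf4.reg _ (by decide),
      hf3.reg _ (by decide), hd12] at e1
  have e2 := hf6.reg rD2 (by decide)
  rw [hf5.reg _ (by decide), hf4.reg _ (by decide),
      hf3.reg _ (by decide), hd22] at e2
  refine Runs.eval rfl (by decide) ⟨?_, ?_, ?_, ?_⟩
  · simp [Prog.eval, eR, eS]; ring
  · simp [Prog.eval, eR, eW, e1]; ring
  · intro hk'
    obtain ⟨d, rfl⟩ : ∃ d, st = k + 1 + d := ⟨st - (k + 1), by omega⟩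
    have h1 : k + 1 + d - k = d + 1 := by omega
    have h2 : k + 1 + d - (k + 1) = d := by omega
    rw [h1] at e2
    rw [h2]
    simp [Prog.eval, eR, e2]
    rw [add_mul]
    omega
  · simp only [Prog.eval, State.setReg_arr]
    refine h6.congr fun a => ?_
    simp only [Set.mem_union, Set.mem_ofPred_eq]
    constructor
    · rintro ((⟨r, hr, x, hx, hT, h⟩ | ⟨x, hx, hT, rfl⟩) | ⟨x, hx, hT, rfl⟩)
      · exact ⟨r, by omega, x, hx, hT, h⟩
      · exact ⟨k, by omega, x, hx, hT, Or.inl rfl⟩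
      · exact ⟨k, by omega, x, hx, hT, Or.inr rfl⟩
    · rintro ⟨r, hr, x, hx, hT, h⟩
      rcases Nat.lt_succ_iff_lt_or_eq.mp hr with hr | rfl
      · exact Or.inl (Or.inl ⟨r, hr, x, hx, hT, h⟩)
      · rcases h with rfl | rfl
        · exact Or.inl (Or.inr ⟨x, hx, hT, rfl⟩)
        · exact Or.inr ⟨x, hx, hT, rfl⟩

/-- The codes of the states after a part is finished. -/
def partEndSet (M : ℕ → ℕ) (n st : ℕ) (T : Set ℕ) : Set ℕ :=
  {b | ∃ r < st + 1, ∃ q < n + 1, ∃ y < wQ M n, r * wR M n + q * wQ M n + y ∈ T ∧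
    b = (r + q) * wR M n + y}

/-- The red vertices of the current part become finished, so the block with digits `r`, `q` moves to
row `r + q` with second digit 0. Several blocks may land in the same place; their union is wanted.
-/
theorem partEnd_runs {M : ℕ → ℕ} {n base st : ℕ} {T : Set ℕ} {s : State}
    (hs : Ready M n s) (hbase : s.reg rBase = base) (hst : s.reg rSt = st) (hstn : st ≤ n)
    (hT : ∀ a, Cell (s.arr 4) base T a) (hTB : ∀ a ∈ T, a < wB M n) :
    Runs .partEnd s ((st + 1) * ((n + 1) * (wQ M n * 9 + 9) + 7) + 11)
      (fun s' => s'.reg rBase = base + wB M n ∧ s'.reg rSt = s.reg rSt2 ∧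
        ∀ a, Cell (s'.arr 4) (base + wB M n) (partEndSet M n st T) a) := by
  unfold Prog.partEnd
  refine Runs.weaken (T := 7 + (((st + 1) * ((1 + (((n + 1) * ((2 + ((wQ M n * 9 + 2) + 2)) + 3)
    + 2) + 1)) + 3) + 2) + 2)) ?_ (by ring_nf; omega) (fun _ _ h => h)
  refine (Runs.eval (T := 7) (Q := fun s' => s'.reg rNew = base + wB M n ∧
      s'.reg rSrc = base ∧ s'.reg rD1 = base + wB M n ∧ s'.reg rLim = st + 1 ∧
      s'.reg rBL = wQ M n) rfl (by decide)
    (by simp [Prog.eval, Prog.inc, hbase, hst, hs.b, hs.q])).seq fun s1 hf1 h1 => ?_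
  obtain ⟨hnew1, hsrc1, hd1, hlim, hbl⟩ := h1
  have hR1 := hs.frame hf1 (by decide) (by decide)
  refine Runs.seq (R := fun s' => Layers (s'.arr 4) base (wB M n) T (partEndSet M n st T)) ?_
    fun s2 hf2 h2 => Runs.eval rfl (by decide) ?_
  swap
  · simp [Prog.eval, hf2.reg rNew (by decide), hnew1, hf2.reg rSt2 (by decide),
      hf1.reg rSt2 (by decide), h2.2]
  refine (Runs.forLt (T := 1 + (((n + 1) * ((2 + ((wQ M n * 9 + 2) + 2)) + 3) + 2) + 1))
    (I := fun k s' => s'.reg rSrc = base + k * wR M n ∧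
      s'.reg rD1 = base + wB M n + k * wR M n ∧
      Layers (s'.arr 4) base (wB M n) T {b | ∃ r < k, ∃ q < n + 1, ∃ y < wQ M n,
        r * wR M n + q * wQ M n + y ∈ T ∧ b = (r + q) * wR M n + y}) (by decide)
      ?_ ?_).weaken (by rw [hlim]) (fun s' _ h => by rw [hlim] at h; exact h.2.2)
  · refine ⟨by simp [hsrc1], by simp [hd1], ?_⟩
    refine (Layers.of_cell (D := s1.arr 4) (fun a => ?_) hTB).congr (by simp)
    rw [hf1.arr 4 (by decide)]; exact hT a
  intro k s2 hk hf2 hr2 hI2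
  rw [hlim] at hk
  have hR2 := hR1.frame hf2 (by decide) (by decide)
  obtain ⟨hsrc2, hd12, hlay⟩ := hI2
  have hbl2 : s2.reg rBL = wQ M n := by rw [hf2.reg _ (by decide), hbl]
  refine (Runs.eval (T := 1) (Q := fun s' => s'.reg rD2 = base + wB M n + k * wR M n) rfl
    (by decide) (by simp [Prog.eval, hd12])).seq fun s3 hf3 h3 => ?_
  have hR3 := hR2.frame hf3 (by decide) (by decide)
  refine Runs.seq (R := fun s' => s'.reg rSrc = base + (k + 1) * wR M n ∧
    Layers (s'.arr 4) base (wB M n) T {b | ∃ r < k + 1, ∃ q < n + 1, ∃ y < wQ M n,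
        r * wR M n + q * wQ M n + y ∈ T ∧ b = (r + q) * wR M n + y}) ?_
    fun s4 hf4 h4 => Runs.eval rfl (by decide) ?_
  swap
  · have e1 : s4.reg rD1 = base + wB M n + k * wR M n := by
      rw [hf4.reg _ (by decide), hf3.reg _ (by decide), hd12]
    have eR : s4.reg rR = wR M n := by
      rw [hf4.reg _ (by decide), hR3.r]
    refine ⟨by simp [Prog.eval, h4.1], ?_, by simpa [Prog.eval] using h4.2⟩
    simp [Prog.eval, e1, eR]; ring
  -- A row consists of exactly `n + 1` blocks, so after the inner loop `rSrc` already points to the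
  -- next row.
  have hwR : wR M n = (n + 1) * wQ M n := rfl
  refine (Runs.forLt (T := 2 + ((wQ M n * 9 + 2) + 2))
    (I := fun l s' => s'.reg rSrc = base + (k * wR M n + l * wQ M n) ∧
      s'.reg rD2 = base + wB M n + (k + l) * wR M n ∧
      Layers (s'.arr 4) base (wB M n) T ({b | ∃ r < k, ∃ q < n + 1, ∃ y < wQ M n,
        r * wR M n + q * wQ M n + y ∈ T ∧ b = (r + q) * wR M n + y} ∪
        {b | ∃ q < l, ∃ y < wQ M n, k * wR M n + q * wQ M n + y ∈ T ∧ b = (k + q) * wR M n + y}))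
      (by decide) ?_ ?_).weaken (by rw [hR3.ns]) ?_
  · refine ⟨by simp [hf3.reg rSrc (by decide), hsrc2], by simp [h3], ?_⟩
    simp only [State.setReg_arr]
    rw [hf3.arr 4 (by decide)]
    exact hlay.congr (by simp)
  · intro l s4 hl hf4 hq4 hI4
    rw [hR3.ns] at hl
    have hR4 := hR3.frame hf4 (by decide) (by decide)
    obtain ⟨hsrc4, hd4, hlay4⟩ := hI4
    have hkB : k * wR M n + l * wQ M n + wQ M n ≤ wB M n := by
      have h1 : k + 1 ≤ n + 1 := by omega
      have h2 : l + 1 ≤ n + 1 := by omega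
      calc k * wR M n + l * wQ M n + wQ M n = k * wR M n + (l + 1) * wQ M n := by ring
        _ ≤ k * wR M n + wR M n := Nat.add_le_add_left (Nat.mul_le_mul_right _ h2) _
        _ = (k + 1) * wR M n := by ring
        _ ≤ wB M n := Nat.mul_le_mul_right _ h1
    refine (Runs.eval (T := 2) (Q := fun s' => s'.reg rBS = base + (k * wR M n + l * wQ M n) ∧
      s'.reg rBD = base + wB M n + (k + l) * wR M n ∧ s'.arr 4 = s4.arr 4) rfl (by decide)
      (by simp [Prog.eval, hsrc4, hd4])).seq fun s5 hf5 h5 => ?_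
    refine (block_runs (L := wQ M n) (by rw [h5.2.2]; exact hlay4) h5.1 h5.2.1
      (by rw [hf5.reg _ (by decide), hf4.reg _ (by decide), hf3.reg _ (by decide), hbl2])
      hkB).seq fun s6 hf6 h6 => ?_
    have eR : s6.reg rR = wR M n := by
      rw [hf6.reg _ (by decide), hf5.reg _ (by decide), hR4.r]
    have eQ : s6.reg rQ = wQ M n := by
      rw [hf6.reg _ (by decide), hf5.reg _ (by decide), hR4.q]
    have eS := hf6.reg rSrc (by decide)
    rw [hf5.reg _ (by decide), hsrc4] at eS
    have e2 := hf6.reg rD2 (by decide)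
    rw [hf5.reg _ (by decide), hd4] at e2
    refine Runs.eval rfl (by decide) ⟨?_, ?_, ?_⟩
    · simp [Prog.eval, eQ, eS]; ring
    · simp [Prog.eval, eR, e2]; ring
    · simp only [Prog.eval, State.setReg_arr]
      refine h6.congr fun a => ?_
      simp only [Set.mem_union, Set.mem_ofPred_eq]
      constructor
      · rintro ((h | ⟨q, hq, y, hy, h⟩) | ⟨x, hx, hT, rfl⟩)
        · exact Or.inl h
        · exact Or.inr ⟨q, by omega, y, hy, h⟩
        · exact Or.inr ⟨l, by omega, x, hx, hT, rfl⟩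
      · rintro (h | ⟨q, hq, y, hy, hT, h⟩)
        · exact Or.inl (Or.inl h)
        · rcases Nat.lt_succ_iff_lt_or_eq.mp hq with hq | rfl
          · exact Or.inl (Or.inr ⟨q, hq, y, hy, hT, h⟩)
          · exact Or.inr ⟨y, hy, hT, h⟩
  · intro s4 hf4 h4
    rw [hR3.ns] at h4
    refine ⟨by rw [h4.1, hwR]; ring, h4.2.2.congr fun a => ?_⟩
    simp only [Set.mem_union, Set.mem_ofPred_eq]
    constructor
    · rintro (⟨r, hr, h⟩ | h)
      · exact ⟨r, by omega, h⟩
      · exact ⟨k, by omega, h⟩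
    · rintro ⟨r, hr, h⟩
      rcases Nat.lt_succ_iff_lt_or_eq.mp hr with hr | rfl
      · exact Or.inl ⟨r, hr, h⟩
      · exact Or.inr h

/-- A bound on the running time of `Prog.step`. -/
def stepTime (M : ℕ → ℕ) (n : ℕ) : ℕ := n * 17 + 16 + (n + 1) * (wR M n * 18 + 16)

/-- A bound on the running time of `Prog.partEnd`. -/
def partEndTime (M : ℕ → ℕ) (n : ℕ) : ℕ := (n + 1) * ((n + 1) * (wQ M n * 9 + 9) + 7) + 11

/-- The last layer of the table shows `T`. -/
def Shows (s : State) (T : Set ℕ) : Prop := ∀ a, Cell (s.arr 4) (s.reg rBase) T a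

/-- Stated for any `T` and `cnt` that obey the recursions, which separates the machine from the
combinatorics. `rSt` is frozen during a part, since vertices of the same part are not adjacent;
`rSt2` counts on and replaces it at the end of the part. The time bound charges a full `step` to
every pair `i`, `j`, even if `j` is skipped. -/
theorem table_runs {M : ℕ → ℕ} {n : ℕ} {col : ℕ → ℕ} {T : ℕ → ℕ → Set ℕ} {cnt : ℕ → ℕ → ℕ}
    {s : State} (hs : Ready M n s) (hcol : ∀ v < n, s.arr 3 v = col v)
    (hst : s.reg rSt = cnt 0 0) (hst2 : s.reg rSt2 = cnt 0 0) (hT0 : Shows s (T 0 0))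
    (hTB : ∀ i j, ∀ a ∈ T i j, a < wB M n)
    (hcnt : ∀ i, cnt i 0 ≤ n)
    (hstep : ∀ i < n, ∀ j < n, part M n j = i → cnt i (j + 1) = cnt i j + 1 ∧
      T i (j + 1) = stepSet M n (cnt i 0) (nbrCount M n col 1 j) (nbrCount M n col 2 j) (T i j))
    (hskip : ∀ i < n, ∀ j < n, part M n j ≠ i → cnt i (j + 1) = cnt i j ∧ T i (j + 1) = T i j)
    (hend : ∀ i < n, cnt (i + 1) 0 = cnt i n ∧
      T (i + 1) 0 = partEndSet M n (cnt i 0) (T i n)) :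
    Runs .table s (n * (n * (stepTime M n + 5) + partEndTime M n + 5) + 2)
      (fun s' => Shows s' (T n 0)) := by
  unfold Prog.table
  refine (Runs.forLt (T := (n * ((1 + (stepTime M n + 1)) + 3) + 2) + partEndTime M n)
    (I := fun i s' => s'.reg rSt = cnt i 0 ∧ s'.reg rSt2 = cnt i 0 ∧ Shows s' (T i 0))
    (by decide) (by simpa [hst, hst2, Shows] using hT0) ?_).weaken
    (by rw [hs.num]; ring_nf; omega) (fun s' _ h => by rw [hs.num] at h; exact h.2.2)
  intro i s1 hi hf1 hi1 hI1
  rw [hs.num] at hi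
  have hR1 := hs.frame hf1 (by decide) (by decide)
  have hc1 : ∀ v < n, s1.arr 3 v = col v := by rwa [hf1.arr 3 (by decide)]
  refine Runs.seq (R := fun s' => s'.reg rSt2 = cnt i n ∧ Shows s' (T i n)) ?_
    fun s2 hf2 h2 => ?_
  · refine (Runs.forLt (T := 1 + (stepTime M n + 1))
      (I := fun j s' => s'.reg rSt2 = cnt i j ∧ Shows s' (T i j)) (by decide)
      ?_ ?_).weaken (by rw [hR1.num]) (fun s' _ h => by rwa [hR1.num] at h)
    · simpa [Shows, hI1.2.1] using hI1.2.2
    intro j s2 hj hf2 hj2 hI2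
    rw [hR1.num] at hj
    have hR2 := hR1.frame hf2 (by decide) (by decide)
    refine (Runs.eval (T := 1) (Q := fun s' => s'.reg rT = part M n j) rfl (by decide)
      (by simp [Prog.eval, hj2, hR2.parts j hj])).seq fun s3 hf3 h3 => ?_
    have hR3 := hR2.frame hf3 (by decide) (by decide)
    have hi3 : s3.reg rI = i := by
      rw [hf3.reg _ (by decide), hf2.reg _ (by decide), hi1]
    have hS3 : Shows s3 (T i j) := by
      unfold Shows
      rw [hf3.arr 4 (by decide), hf3.reg _ (by decide)]
      exact hI2.2
    have hst3 : s3.reg rSt = cnt i 0 := by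
      rw [hf3.reg _ (by decide), hf2.reg _ (by decide), hI1.1]
    have hst23 : s3.reg rSt2 = cnt i j := by
      rw [hf3.reg _ (by decide), hI2.1]
    refine Runs.ite (fun hb => ?_) (fun hb => Runs.eval rfl (by simp [Prog.cost]; unfold stepTime; omega) ?_)
    · have hp : part M n j = i := by simpa [Test.holds, h3, hi3] using hb
      refine (step_runs (T := T i j) (col := col) hR3 ?_ rfl hst3
        (by rw [hf3.reg _ (by decide), hj2]) hj (hcnt i) hS3 (hTB i j)).weaken ?_ ?_
      · rw [hf3.arr 3 (by decide), hf2.arr 3 (by decide)]; exact hc1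
      · unfold stepTime
        have := Nat.mul_le_mul_right (wR M n * 18 + 16) (Nat.add_le_add_right (hcnt i) 1)
        omega
      · rintro s4 hf4 ⟨h1, h2, h5⟩
        obtain ⟨e1, e2⟩ := hstep i hi j hj hp
        refine ⟨by simp [h2, hst23, e1], ?_⟩
        rw [e2]
        simpa [Shows, h1] using h5
    · have hp : part M n j ≠ i := by simpa [Test.holds, h3, hi3] using hb
      obtain ⟨e1, e2⟩ := hskip i hi j hj hp
      refine ⟨by simp [Prog.eval, hst23, e1], ?_⟩
      rw [e2]
      simpa [Shows, Prog.eval] using hS3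
  · have hR2 := hR1.frame hf2 (by decide) (by decide)
    refine (partEnd_runs (T := T i n) hR2 rfl (by rw [hf2.reg _ (by decide), hI1.1]) (hcnt i)
      h2.2 (hTB i n)).weaken ?_ ?_
    · unfold partEndTime
      have := Nat.mul_le_mul_right ((n + 1) * (wQ M n * 9 + 9) + 7)
        (Nat.add_le_add_right (hcnt i) 1)
      omega
    · rintro s3 hf3 ⟨h1, h3, h4⟩
      obtain ⟨e1, e2⟩ := hend i hi
      have h5 : s3.reg rSt2 = cnt i n := by rw [hf3.reg _ (by decide), h2.1]
      refine ⟨by simp [h3, h2.1, e1], by simp [h5, e1], ?_⟩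
      rw [e2]
      simpa [Shows, h1] using h4

/-- Register `0` contains the truth value of `P`. -/
def Answer (s : State) (P : Prop) : Prop := (P → s.reg 0 = 1) ∧ (¬ P → s.reg 0 = 0)

theorem Answer.congr {s : State} {P P' : Prop} (h : Answer s P) (hP : P ↔ P') : Answer s P' := by
  rwa [← propext hP]

/-- After the end of a part the digit `q` is 0, so only the first `wE * wE` cells of each row
matter. The loop counters run through `e₁` and `e₂`, so no code is decoded. `P` is the answer of the
earlier rounds; register `0` is only ever raised to 1. -/
theorem scan_runs {M : ℕ → ℕ} {n : ℕ} {T : Set ℕ} {P : Prop} {s : State} (hs : Ready M n s)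
    (hT : Shows s T) (hP : Answer s P) :
    Runs .scan s ((n + 1) * (wE M n * (wE M n * 12 + 5) + 7) + 3) (fun s' => Answer s'
      (P ∨ ∃ r < n + 1, ∃ e₁ < wE M n, ∃ e₂ < wE M n, r * wR M n + e₁ * wE M n + e₂ ∈ T ∧
        2 * M 1 ≤ e₁ ∧ 2 * M 3 ≤ e₂)) := by
  unfold Prog.scan
  refine ((Runs.eval (T := 1) (Q := fun s' => s'.reg rSrc = s.reg rBase ∧ Answer s' P) rfl
    (by decide) (by simpa [Prog.eval, Answer] using hP)).seq fun s1 hf1 h1 => ?_).weaken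
    (T := 1 + ((n + 1) * ((1 + ((wE M n * ((wE M n * (9 + 3) + 2) + 3) + 2) + 1)) + 3) + 2))
    (by ring_nf; omega) (fun _ _ h => h)
  have hR1 := hs.frame hf1 (by decide) (by decide)
  have hT1 : Shows s1 T := by
    unfold Shows
    rw [hf1.arr 4 (by decide), hf1.reg _ (by decide)]
    exact hT
  rw [show s.reg rBase = s1.reg rBase by rw [hf1.reg _ (by decide)]] at h1
  refine (Runs.forLt (T := 1 + ((wE M n * ((wE M n * (9 + 3) + 2) + 3) + 2) + 1))
    (I := fun k s' => s'.reg rSrc = s1.reg rBase + k * wR M n ∧ Answer s' (P ∨ ∃ r < k,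
      ∃ e₁ < wE M n, ∃ e₂ < wE M n, r * wR M n + e₁ * wE M n + e₂ ∈ T ∧
        2 * M 1 ≤ e₁ ∧ 2 * M 3 ≤ e₂)) (by decide)
    (by simpa [h1.1, Answer] using h1.2) ?_).weaken (by rw [hR1.ns])
    (fun s' _ h => by rw [hR1.ns] at h; exact h.2)
  intro k s2 hk hf2 hr2 hI2
  rw [hR1.ns] at hk
  have hR2 := hR1.frame hf2 (by decide) (by decide)
  refine (Runs.eval (T := 1) (Q := fun s' => s'.reg rPtr = s1.reg rBase + k * wR M n ∧
    s'.reg 0 = s2.reg 0) rfl (by decide) (by simp [Prog.eval, hI2.1])).seq fun s3 hf3 h3 => ?_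
  have hR3 := hR2.frame hf3 (by decide) (by decide)
  refine Runs.seq (R := fun s' => Answer s' (P ∨ ∃ r < k + 1,
      ∃ e₁ < wE M n, ∃ e₂ < wE M n, r * wR M n + e₁ * wE M n + e₂ ∈ T ∧
        2 * M 1 ≤ e₁ ∧ 2 * M 3 ≤ e₂)) ?_ fun s4 hf4 h4 => Runs.eval rfl (by decide) ?_
  swap
  · have hR4 := hR3.frame hf4 (by decide) (by decide)
    have e1 : s4.reg rSrc = s1.reg rBase + k * wR M n := by
      rw [hf4.reg _ (by decide), hf3.reg _ (by decide), hI2.1]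
    refine ⟨by simp [Prog.eval, e1, hR4.r]; ring, by simpa [Answer, Prog.eval] using h4⟩
  refine (Runs.forLt (T := wE M n * (9 + 3) + 2)
    (I := fun e s' => s'.reg rPtr = s1.reg rBase + (k * wR M n + e * wE M n) ∧
      Answer s' ((P ∨ ∃ r < k, ∃ e₁ < wE M n, ∃ e₂ < wE M n, r * wR M n + e₁ * wE M n + e₂ ∈ T ∧
        2 * M 1 ≤ e₁ ∧ 2 * M 3 ≤ e₂) ∨ ∃ e₁ < e, ∃ e₂ < wE M n,
        k * wR M n + e₁ * wE M n + e₂ ∈ T ∧ 2 * M 1 ≤ e₁ ∧ 2 * M 3 ≤ e₂)) (by decide)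
    (by simpa [h3, Answer] using hI2.2) ?_).weaken (by rw [hR3.w]) ?_
  swap
  · intro s4 _ h4
    rw [hR3.w] at h4
    refine h4.2.congr ?_
    rw [or_assoc]
    refine or_congr Iff.rfl ⟨?_, ?_⟩
    · rintro (⟨r, hr, h⟩ | h)
      · exact ⟨r, by omega, h⟩
      · exact ⟨k, by omega, h⟩
    · rintro ⟨r, hr, h⟩
      rcases Nat.lt_succ_iff_lt_or_eq.mp hr with hr | rfl
      · exact Or.inl ⟨r, hr, h⟩
      · exact Or.inr h
  intro e s4 he hf4 hu4 hI4
  rw [hR3.w] at he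
  have hR4 := hR3.frame hf4 (by decide) (by decide)
  -- The answer so far is only a disjunct that is carried along.
  generalize (P ∨ ∃ r < k, ∃ e₁ < wE M n, ∃ e₂ < wE M n, r * wR M n + e₁ * wE M n + e₂ ∈ T ∧
        2 * M 1 ≤ e₁ ∧ 2 * M 3 ≤ e₂) = P' at hI4 ⊢
  refine (Runs.forLt (T := 9)
    (I := fun f s' => s'.reg rPtr = s1.reg rBase + (k * wR M n + e * wE M n + f) ∧
      Answer s' ((P' ∨ ∃ e₁ < e, ∃ e₂ < wE M n,
        k * wR M n + e₁ * wE M n + e₂ ∈ T ∧ 2 * M 1 ≤ e₁ ∧ 2 * M 3 ≤ e₂) ∨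
        ∃ e₂ < f, k * wR M n + e * wE M n + e₂ ∈ T ∧ 2 * M 1 ≤ e ∧ 2 * M 3 ≤ e₂)) (by decide)
    (by simpa [Answer] using hI4) ?_).weaken (by rw [hR4.w]) ?_
  swap
  · intro s5 _ h5
    rw [hR4.w] at h5
    refine ⟨by simp [h5.1]; ring, ?_⟩
    have h6 : ∀ R, Answer s5 R → Answer ((s5.setReg rTmp 1).setReg rU (e + 1)) R := fun R h => by
      simpa [Answer] using h
    refine (h6 _ h5.2).congr ?_
    rw [or_assoc]
    refine or_congr Iff.rfl ⟨?_, ?_⟩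
    · rintro (⟨r, hr, h⟩ | h)
      · exact ⟨r, by omega, h⟩
      · exact ⟨e, by omega, h⟩
    · rintro ⟨r, hr, h⟩
      rcases Nat.lt_succ_iff_lt_or_eq.mp hr with hr | rfl
      · exact Or.inl ⟨r, hr, h⟩
      · exact Or.inr h
  intro f s5 hf hf5 hv5 hI5
  rw [hR4.w] at hf
  have hR5 := hR4.frame hf5 (by decide) (by decide)
  have hu5 : s5.reg rU = e := by rw [hf5.reg _ (by decide), hu4]
  have hcell : Cell (s5.arr 4) (s1.reg rBase) T (k * wR M n + e * wE M n + f) := by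
    rw [hf5.arr 4 (by decide), hf4.arr 4 (by decide), hf3.arr 4 (by decide),
      hf2.arr 4 (by decide)]
    exact hT1 _
  obtain ⟨hptr, hans⟩ := hI5
  rw [Cell, ← hptr] at hcell
  generalize (P' ∨ ∃ e₁ < e, ∃ e₂ < wE M n,
        k * wR M n + e₁ * wE M n + e₂ ∈ T ∧ 2 * M 1 ≤ e₁ ∧ 2 * M 3 ≤ e₂) = P'' at hans ⊢
  have hsucc : (∃ e₂ < f + 1, k * wR M n + e * wE M n + e₂ ∈ T ∧ 2 * M 1 ≤ e ∧ 2 * M 3 ≤ e₂) ↔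
      (∃ e₂ < f, k * wR M n + e * wE M n + e₂ ∈ T ∧ 2 * M 1 ≤ e ∧ 2 * M 3 ≤ e₂) ∨
      (k * wR M n + e * wE M n + f ∈ T ∧ 2 * M 1 ≤ e ∧ 2 * M 3 ≤ f) := by
    constructor
    · rintro ⟨r, hr, h⟩
      rcases Nat.lt_succ_iff_lt_or_eq.mp hr with hr | rfl
      · exact Or.inl ⟨r, hr, h⟩
      · exact Or.inr h
    · rintro (⟨r, hr, h⟩ | h)
      · exact ⟨r, by omega, h⟩
      · exact ⟨f, by omega, h⟩
  rw [hsucc, ← or_assoc]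
  generalize (P'' ∨ ∃ e₂ < f, k * wR M n + e * wE M n + e₂ ∈ T ∧ 2 * M 1 ≤ e ∧ 2 * M 3 ≤ e₂) = R
    at hans ⊢
  have hnext : s1.reg rBase + (k * wR M n + e * wE M n + (f + 1)) = s5.reg rPtr + 1 := by
    rw [hptr]; ring
  rw [hnext]
  refine Runs.eval rfl (by decide) ?_
  generalize k * wR M n + e * wE M n + f = a at hcell
  by_cases h : a ∈ T
  · have hc := hcell.1 h
    by_cases h1 : 2 * M 1 ≤ e
    · by_cases h2 : 2 * M 3 ≤ f
      · simp [Prog.eval, Prog.ifEq, Prog.inc, Test.holds, hc, hu5, hv5, hR5.k1, hR5.k2, h, h1, h2,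
          Answer, Nat.not_lt.mpr h1, Nat.not_lt.mpr h2]
      · simp [Prog.eval, Prog.ifEq, Prog.inc, Test.holds, hc, hu5, hv5, hR5.k1, hR5.k2, h1, h2,
          Nat.not_lt.mpr h1, Nat.lt_of_not_le h2]
        simpa [Answer] using hans
    · simp [Prog.eval, Prog.ifEq, Prog.inc, Test.holds, hc, hu5, hR5.k1, h1,
        Nat.lt_of_not_le h1]
      simpa [Answer] using hans
  · have hc := hcell.2 h
    simp [Prog.eval, Prog.ifEq, Prog.inc, Test.holds, hc, h]
    simpa [Answer] using hans

/-! ### Correctness of the dynamic program -/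

section DynamicProgram

variable {M : ℕ → ℕ} {n : ℕ}

/-- The vertices outside the given set induce a co-cluster graph. -/
structure CoclusterInput (M : ℕ → ℕ) (n : ℕ) : Prop where
  symm : ∀ u < n, ∀ v < n, Adj M n u v → Adj M n v u
  irrefl : ∀ u < n, ¬ Adj M n u u
  trans : ∀ u < n, ∀ v < n, ∀ w < n, ¬ InX M n u → ¬ InX M n v → ¬ InX M n w →
    ¬ Adj M n u v → ¬ Adj M n v w → ¬ Adj M n u w

/-! ### Parts as classes of non-adjacency -/

theorem lastSat_spec {p : ℕ → Prop} [DecidablePred p] (d : ℕ) {m k : ℕ} (hk : k < m) (hp : p k) :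
    lastSat p d m < m ∧ p (lastSat p d m) := by
  induction m with
  | zero => omega
  | succ m ih =>
    unfold lastSat
    split_ifs with h
    · exact ⟨by omega, h⟩
    · have hkm : k ≠ m := fun hc => h (hc ▸ hp)
      have := ih (by omega)
      exact ⟨by omega, this.2⟩

theorem lastSat_congr {p q : ℕ → Prop} [DecidablePred p] [DecidablePred q] (d : ℕ) {m : ℕ}
    (h : ∀ k < m, p k ↔ q k) : lastSat p d m = lastSat q d m := by
  induction m with
  | zero => rfl
  | succ m ih =>
    unfold lastSat
    rw [ih fun k hk => h k (by omega)]
    simp only [h m (by omega)]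

theorem part_of_inX {v : ℕ} (h : InX M n v) : part M n v = n := if_pos h

/-- By irreflexivity `v` itself is a candidate, so the search for a representative never returns its
default value. -/
theorem CoclusterInput.part_spec (hG : CoclusterInput M n) {v : ℕ} (hv : v < n)
    (hX : ¬ InX M n v) : part M n v < n ∧ ¬ InX M n (part M n v) ∧ ¬ Adj M n v (part M n v) := by
  rw [part, if_neg hX]
  exact lastSat_spec (p := fun w => ¬ InX M n w ∧ ¬ Adj M n v w) n hv ⟨hX, hG.irrefl v hv⟩

/-- Equal representatives link `u` and `v` by transitivity of non-adjacency. Conversely,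
non-adjacent vertices have the same non-neighbors outside the given set, so the two searches agree.
-/
theorem CoclusterInput.part_eq_iff (hG : CoclusterInput M n) {u v : ℕ} (hu : u < n) (hv : v < n)
    (hXu : ¬ InX M n u) (hXv : ¬ InX M n v) : part M n u = part M n v ↔ ¬ Adj M n u v := by
  constructor
  · intro h
    obtain ⟨h1, h2, h3⟩ := hG.part_spec hu hXu
    obtain ⟨-, -, h6⟩ := hG.part_spec hv hXv
    rw [← h] at h6
    exact hG.trans u hu _ h1 v hv hXu h2 hXv h3 fun hc => h6 (hG.symm _ h1 _ hv hc)
  · intro h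
    rw [part, if_neg hXu, part, if_neg hXv]
    refine lastSat_congr n fun w hw => ?_
    refine and_congr_right fun hXw => not_congr ⟨fun hc => ?_, fun hc => ?_⟩
    · by_contra hn
      exact hG.trans u hu v hv w hw hXu hXv hXw h hn hc
    · by_contra hn
      exact hG.trans v hv u hu w hw hXv hXu hXw (fun hc => h (hG.symm v hv u hu hc)) hn hc

/-! ### States and their mixed radix codes -/

/-- The number of ordered pairs of adjacent vertices in `S` that both have color `b`. -/
def monoPairs (M : ℕ → ℕ) (n : ℕ) (S : Finset ℕ) (f : ℕ → Bool) (b : Bool) : ℕ :=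
  ∑ u ∈ S, ∑ v ∈ S, if Adj M n u v ∧ f u = b ∧ f v = b then 1 else 0

/-- The vertices of the given set, of the parts before `i`, and those below `j` of part `i`. -/
def seen (M : ℕ → ℕ) (n i j : ℕ) : Finset ℕ :=
  {v ∈ Finset.range n | InX M n v ∨ part M n v < i ∨ (part M n v = i ∧ v < j)}

/-- The number of seen vertices outside the given set. -/
def seenCount (M : ℕ → ℕ) (n i j : ℕ) : ℕ :=
  Finset.card {v ∈ Finset.range n | part M n v < i ∨ (part M n v = i ∧ v < j)}

/-- The number of vertices of color `b` in the parts before `i`. -/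
def before (M : ℕ → ℕ) (n i : ℕ) (f : ℕ → Bool) (b : Bool) : ℕ :=
  Finset.card {v ∈ Finset.range n | part M n v < i ∧ f v = b}

/-- The number of red vertices below `j` in part `i`. -/
def inside (M : ℕ → ℕ) (n i j : ℕ) (f : ℕ → Bool) : ℕ :=
  Finset.card {v ∈ Finset.range n | part M n v = i ∧ v < j ∧ f v = true}

/-- The code of the numbers of red and blue pairs. -/
def pairsCode (M : ℕ → ℕ) (n : ℕ) (S : Finset ℕ) (f : ℕ → Bool) : ℕ :=
  monoPairs M n S f true * wE M n + monoPairs M n S f false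

/-- The code of the state reached by a coloring. -/
def stateCode (M : ℕ → ℕ) (n i j : ℕ) (f : ℕ → Bool) : ℕ :=
  before M n i f true * wR M n + (inside M n i j f * wQ M n + pairsCode M n (seen M n i j) f)

/-- The coloring `f` extends the coloring `col` of the given set. -/
def Extends (M : ℕ → ℕ) (n : ℕ) (col : ℕ → ℕ) (f : ℕ → Bool) : Prop :=
  ∀ v < n, InX M n v → (col v = 1 ↔ f v = true)

/-- The codes of all states that are reached by colorings that extend `col`. -/
def reached (M : ℕ → ℕ) (n : ℕ) (col : ℕ → ℕ) (i j : ℕ) : Set ℕ :=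
  {a | ∃ f, Extends M n col f ∧ a = stateCode M n i j f}

theorem seen_subset (i j : ℕ) : seen M n i j ⊆ Finset.range n := Finset.filter_subset _ _

/-- This is why `wE` can serve as radix: it is one more than the number of all ordered adjacent
pairs. The next bounds extend this to the higher digits. -/
theorem monoPairs_lt {S : Finset ℕ} (hS : S ⊆ Finset.range n) (f : ℕ → Bool) (b : Bool) :
    monoPairs M n S f b < wE M n := by
  unfold wE pairCount monoPairs
  rw [Nat.lt_one_add_iff]
  refine (Finset.sum_le_sum_of_subset hS).trans (Finset.sum_le_sum fun u _ =>
    (Finset.sum_le_sum_of_subset hS).trans (Finset.sum_le_sum fun v _ => ?_))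
  split_ifs with h h' <;> first | omega | exact absurd h.1 h'

theorem pairsCode_lt {S : Finset ℕ} (hS : S ⊆ Finset.range n) (f : ℕ → Bool) :
    pairsCode M n S f < wQ M n := by
  have h1 := monoPairs_lt (M := M) hS f true
  have h2 := monoPairs_lt (M := M) hS f false
  unfold pairsCode wQ
  calc _ < monoPairs M n S f true * wE M n + wE M n := by omega
    _ = (monoPairs M n S f true + 1) * wE M n := by ring
    _ ≤ _ := Nat.mul_le_mul_right _ h1

theorem card_filter_range_le (p : ℕ → Prop) [DecidablePred p] :
    Finset.card {v ∈ Finset.range n | p v} ≤ n :=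
  (Finset.card_filter_le _ _).trans (by simp)

theorem lower_lt {q x : ℕ} (hq : q ≤ n) (hx : x < wQ M n) : q * wQ M n + x < wR M n := by
  unfold wR
  calc _ < q * wQ M n + wQ M n := by omega
    _ = (q + 1) * wQ M n := by ring
    _ ≤ _ := Nat.mul_le_mul_right _ (by omega)

theorem state_lt (i j : ℕ) (f : ℕ → Bool) :
    inside M n i j f * wQ M n + pairsCode M n (seen M n i j) f < wR M n :=
  lower_lt (card_filter_range_le _) (pairsCode_lt (seen_subset i j) f)

theorem stateCode_lt (i j : ℕ) (f : ℕ → Bool) : stateCode M n i j f < wB M n := by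
  have h1 := state_lt (M := M) (n := n) i j f
  have h2 : before M n i f true ≤ n := card_filter_range_le _
  unfold stateCode wB
  calc _ < before M n i f true * wR M n + wR M n := by omega
    _ = (before M n i f true + 1) * wR M n := by ring
    _ ≤ _ := Nat.mul_le_mul_right _ (by omega)

/-- Uniqueness of digits, by which the components of a state are recovered from its code. -/
theorem eq_of_digits {w a b x y : ℕ} (hx : x < w) (hy : y < w) (h : a * w + x = b * w + y) :
    a = b ∧ x = y := by
  have key : ∀ c z, z < w → (c * w + z) / w = c := fun c z hz => by
    rw [mul_comm, Nat.mul_add_div (by omega), Nat.div_eq_of_lt hz, add_zero]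
  have hab : a = b := by rw [← key a x hx, h, key b y hy]
  subst hab
  exact ⟨rfl, by omega⟩

/-- With the next two lemmas: the state depends only on the colors of seen vertices, so the next
vertex can be recolored freely. -/
theorem monoPairs_congr {S : Finset ℕ} {f f' : ℕ → Bool} (h : ∀ v ∈ S, f v = f' v) (b : Bool) :
    monoPairs M n S f b = monoPairs M n S f' b :=
  Finset.sum_congr rfl fun u hu => Finset.sum_congr rfl fun v hv => by rw [h u hu, h v hv]

theorem before_congr {i j : ℕ} {f f' : ℕ → Bool} (h : ∀ v ∈ seen M n i j, f v = f' v) (b : Bool) :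
    before M n i f b = before M n i f' b := by
  unfold before
  congr 1
  refine Finset.filter_congr fun v hv => and_congr_right fun hp => ?_
  rw [h v (Finset.mem_filter.mpr ⟨hv, Or.inr (Or.inl hp)⟩)]

theorem inside_congr {i j : ℕ} {f f' : ℕ → Bool} (h : ∀ v ∈ seen M n i j, f v = f' v) :
    inside M n i j f = inside M n i j f' := by
  unfold inside
  congr 1
  refine Finset.filter_congr fun v hv => and_congr_right fun hp => and_congr_right fun hj => ?_
  rw [h v (Finset.mem_filter.mpr ⟨hv, Or.inr (Or.inr ⟨hp, hj⟩)⟩)]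

theorem notMem_seen {i j : ℕ} (hi : i < n) (hp : part M n j = i) : j ∉ seen M n i j := by
  intro h
  rcases (Finset.mem_filter.mp h).2 with h | h | h
  · rw [part_of_inX h] at hp; omega
  · omega
  · omega

theorem seen_succ {i j : ℕ} (hj : j < n) (hp : part M n j = i) :
    seen M n i (j + 1) = insert j (seen M n i j) := by
  ext v
  simp only [seen, Finset.mem_filter, Finset.mem_range, Finset.mem_insert]
  constructor
  · rintro ⟨hv, h | h | h⟩
    · exact Or.inr ⟨hv, Or.inl h⟩
    · exact Or.inr ⟨hv, Or.inr (Or.inl h)⟩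
    · by_cases hvj : v = j
      · exact Or.inl hvj
      · exact Or.inr ⟨hv, Or.inr (Or.inr ⟨h.1, by omega⟩)⟩
  · rintro (rfl | ⟨hv, h | h | h⟩)
    · exact ⟨hj, Or.inr (Or.inr ⟨hp, by omega⟩)⟩
    · exact ⟨hv, Or.inl h⟩
    · exact ⟨hv, Or.inr (Or.inl h)⟩
    · exact ⟨hv, Or.inr (Or.inr ⟨h.1, by omega⟩)⟩

/-! ### Coloring one more vertex -/

theorem CoclusterInput.monoPairs_insert (hG : CoclusterInput M n) {S : Finset ℕ}
    (hS : S ⊆ Finset.range n) {j : ℕ} (hj : j < n) (hjS : j ∉ S) (f : ℕ → Bool) (b : Bool) :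
    monoPairs M n (insert j S) f b = monoPairs M n S f b +
      if f j = b then 2 * ∑ u ∈ S, (if Adj M n j u ∧ f u = b then 1 else 0) else 0 := by
  have hlt : ∀ u ∈ S, u < n := fun u hu => Finset.mem_range.mp (hS hu)
  have h1 : ∀ u ∈ S, (if Adj M n u j ∧ f u = b ∧ f j = b then 1 else 0) =
      if f j = b then (if Adj M n j u ∧ f u = b then 1 else 0) else 0 := fun u hu => by
    have : Adj M n u j ↔ Adj M n j u := ⟨hG.symm u (hlt u hu) j hj, hG.symm j hj u (hlt u hu)⟩
    simp only [this]
    split_ifs <;> simp_all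
  have h2 : ∀ u ∈ S, (if Adj M n j u ∧ f j = b ∧ f u = b then 1 else 0) =
      if f j = b then (if Adj M n j u ∧ f u = b then 1 else 0) else 0 := fun u _ => by
    split_ifs <;> simp_all
  unfold monoPairs
  rw [Finset.sum_insert hjS, Finset.sum_insert hjS, if_neg (fun h => hG.irrefl j hj h.1)]
  simp_rw [Finset.sum_insert hjS, Finset.sum_add_distrib]
  rw [Finset.sum_congr rfl h1, Finset.sum_congr rfl h2]
  split_ifs
  · ring
  · simp

/-- Vertex by vertex: the given set contributes to `nbrCount`; vertices of earlier parts are all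
neighbors of `j` and contribute to `before`; seen vertices of its own part are not neighbors. -/
theorem CoclusterInput.sum_seen_nbrs (hG : CoclusterInput M n) {col : ℕ → ℕ} {f : ℕ → Bool}
    {i j k : ℕ} {b : Bool} (hf : ∀ v < n, col v = k ↔ InX M n v ∧ f v = b) (hi : i < n)
    (hj : j < n) (hp : part M n j = i) :
    ∑ u ∈ seen M n i j, (if Adj M n j u ∧ f u = b then 1 else 0) =
      nbrCount M n col k j + before M n i f b := by
  have hjX : ¬ InX M n j := fun h => by rw [part_of_inX h] at hp; omega
  unfold nbrCount before seen
  rw [Finset.sum_filter, Finset.card_filter, ← Finset.sum_add_distrib]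
  refine Finset.sum_congr rfl fun u hu => ?_
  have hu := Finset.mem_range.mp hu
  by_cases hX : InX M n u
  · have hpu := part_of_inX hX
    have : ¬ part M n u < i := by omega
    by_cases hb : f u = b <;> simp [hX, hf u hu, hb, this]
  · have hadj := hG.part_eq_iff hj hu hjX hX
    rw [hp] at hadj
    by_cases h1 : part M n u < i
    · have h2 : Adj M n j u := by
        by_contra hc
        have := hadj.mpr hc
        omega
      simp [hX, hf u hu, h1, h2]
    · by_cases h2 : i = part M n u
      · have h3 : ¬ Adj M n j u := hadj.mp h2
        simp [hX, hf u hu, h1, h3]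
      · have h3 : ¬ part M n u = i := fun h => h2 h.symm
        simp [hX, hf u hu, h1, h3]

/-- The number of blue vertices in finished parts is determined by the number of red ones, so states
do not record it. -/
theorem before_add_before (i : ℕ) (f : ℕ → Bool) :
    before M n i f true + before M n i f false = seenCount M n i 0 := by
  unfold before seenCount
  simp only [Finset.card_filter, ← Finset.sum_add_distrib]
  refine Finset.sum_congr rfl fun u _ => ?_
  by_cases h : part M n u < i <;> cases f u <;> simp [h]

theorem inside_succ {i j : ℕ} (hj : j < n) (hp : part M n j = i) (f : ℕ → Bool) :
    inside M n i (j + 1) f = inside M n i j f + if f j = true then 1 else 0 := by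
  unfold inside
  simp only [Finset.card_filter]
  rw [← Finset.sum_erase_add _ _ (Finset.mem_range.mpr hj),
    ← Finset.sum_erase_add (a := j) (Finset.range n) (fun v =>
      if part M n v = i ∧ v < j ∧ f v = true then 1 else 0) (Finset.mem_range.mpr hj)]
  have : ∀ v ∈ (Finset.range n).erase j, (if part M n v = i ∧ v < j + 1 ∧ f v = true then 1 else 0) =
      if part M n v = i ∧ v < j ∧ f v = true then 1 else 0 := fun v hv => by
    have hvj := Finset.ne_of_mem_erase hv
    have : v < j + 1 ↔ v < j := by omega
    simp only [this]
  rw [Finset.sum_congr rfl this]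
  simp [hp]

theorem seenCount_succ {i j : ℕ} (hj : j < n) (hp : part M n j = i) :
    seenCount M n i (j + 1) = seenCount M n i j + 1 := by
  unfold seenCount
  simp only [Finset.card_filter]
  rw [← Finset.sum_erase_add _ _ (Finset.mem_range.mpr hj),
    ← Finset.sum_erase_add (a := j) (Finset.range n) (fun v =>
      if part M n v < i ∨ part M n v = i ∧ v < j then 1 else 0) (Finset.mem_range.mpr hj)]
  have : ∀ v ∈ (Finset.range n).erase j,
      (if part M n v < i ∨ part M n v = i ∧ v < j + 1 then 1 else 0) =
      if part M n v < i ∨ part M n v = i ∧ v < j then 1 else 0 := fun v hv => by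
    have hvj := Finset.ne_of_mem_erase hv
    have : v < j + 1 ↔ v < j := by omega
    simp only [this]
  rw [Finset.sum_congr rfl this]
  simp [hp]

/-- The coloring `col` uses `1` and `2` on the given set and `0` elsewhere. -/
def IsColoringOfX (M : ℕ → ℕ) (n : ℕ) (col : ℕ → ℕ) : Prop :=
  ∀ v < n, (InX M n v → col v = 1 ∨ col v = 2) ∧ (¬ InX M n v → col v = 0)

theorem Extends.color_iff {col : ℕ → ℕ} {f : ℕ → Bool} (hf : Extends M n col f)
    (hcol : IsColoringOfX M n col) (b : Bool) :
    ∀ v < n, col v = (if b then 1 else 2) ↔ InX M n v ∧ f v = b := by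
  intro v hv
  obtain ⟨h1, h2⟩ := hcol v hv
  by_cases hX : InX M n v
  · have h3 := hf v hv hX
    have h1 := h1 hX
    cases b <;> cases hfv : f v <;> simp [hX, hfv] at h3 ⊢ <;> omega
  · simp [hX, h2 hX]
    cases b <;> simp

/-- How coloring a further vertex changes the state. -/
theorem CoclusterInput.stateCode_succ (hG : CoclusterInput M n) {col : ℕ → ℕ}
    (hcol : IsColoringOfX M n col) {f : ℕ → Bool} (hf : Extends M n col f) {i j : ℕ} (hi : i < n)
    (hj : j < n) (hp : part M n j = i) :
    inside M n i (j + 1) f * wQ M n + pairsCode M n (seen M n i (j + 1)) f =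
      inside M n i j f * wQ M n + pairsCode M n (seen M n i j) f +
      if f j = true then wQ M n + 2 * wE M n * (nbrCount M n col 1 j + before M n i f true)
      else 2 * (nbrCount M n col 2 j + (seenCount M n i 0 - before M n i f true)) := by
  have h1 := hG.sum_seen_nbrs (hf.color_iff hcol true) hi hj hp
  have h2 := hG.sum_seen_nbrs (hf.color_iff hcol false) hi hj hp
  simp only [if_true, Bool.false_eq_true, if_false] at h1 h2
  have h3 : before M n i f false = seenCount M n i 0 - before M n i f true := by
    rw [← before_add_before i f]; omega
  rw [seen_succ hj hp, inside_succ hj hp, pairsCode, pairsCode,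
    hG.monoPairs_insert (seen_subset i j) hj (notMem_seen hi hp),
    hG.monoPairs_insert (seen_subset i j) hj (notMem_seen hi hp), h1, h2, ← h3]
  cases f j <;> simp <;> ring

theorem Extends.update {col : ℕ → ℕ} {f : ℕ → Bool} (hf : Extends M n col f) {j : ℕ}
    (hj : ¬ InX M n j) (b : Bool) : Extends M n col (Function.update f j b) := by
  intro v hv hX
  have : v ≠ j := fun h => hj (h ▸ hX)
  rw [Function.update_of_ne this]
  exact hf v hv hX

/-- For one inclusion the same coloring reaches the previous state. For the other, a coloring that
reaches the previous state is changed at `j` to the chosen color; since `j` is not yet seen, it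
still reaches that state. -/
theorem CoclusterInput.reached_step (hG : CoclusterInput M n) {col : ℕ → ℕ}
    (hcol : IsColoringOfX M n col) {i j : ℕ} (hi : i < n) (hj : j < n) (hp : part M n j = i) :
    reached M n col i (j + 1) = stepSet M n (seenCount M n i 0) (nbrCount M n col 1 j)
      (nbrCount M n col 2 j) (reached M n col i j) := by
  have hjX : ¬ InX M n j := fun h => by rw [part_of_inX h] at hp; omega
  have hle : ∀ f, before M n i f true < seenCount M n i 0 + 1 := fun f => by
    rw [← before_add_before i f]; omega
  ext a
  constructor
  · rintro ⟨f, hf, rfl⟩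
    refine ⟨before M n i f true, hle f, _, state_lt i j f, ⟨f, hf, rfl⟩, ?_⟩
    rw [stateCode, hG.stateCode_succ hcol hf hi hj hp]
    split_ifs
    · left; ring
    · right; ring
  · rintro ⟨r, hr, x, hx, ⟨f, hf, h⟩, ha⟩
    -- The row index is the leading digit, hence the number of finished red vertices of `f`.
    obtain ⟨rfl, rfl⟩ := eq_of_digits hx (state_lt i j f) h
    have hupd : ∀ b, ∀ v ∈ seen M n i j, f v = Function.update f j b v := fun b v hv => by
      rw [Function.update_of_ne]
      exact fun hc => notMem_seen hi hp (hc ▸ hv)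
    have hcode : ∀ b, stateCode M n i (j + 1) (Function.update f j b) =
        before M n i f true * wR M n + (inside M n i j f * wQ M n +
          pairsCode M n (seen M n i j) f +
        if b = true then wQ M n + 2 * wE M n * (nbrCount M n col 1 j + before M n i f true)
        else 2 * (nbrCount M n col 2 j + (seenCount M n i 0 - before M n i f true))) := by
      intro b
      rw [stateCode, hG.stateCode_succ hcol (hf.update hjX b) hi hj hp]
      simp only [pairsCode, ← monoPairs_congr (hupd b), ← before_congr (hupd b),
        ← inside_congr (hupd b), Function.update_self]
    rcases ha with rfl | rfl
    · refine ⟨_, hf.update hjX true, ?_⟩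
      rw [hcode]; simp; ring
    · refine ⟨_, hf.update hjX false, ?_⟩
      rw [hcode]; simp; ring

/-! ### Skipped vertices, ends of parts, first and last layer -/

theorem stateCode_skip {i j : ℕ} (hp : part M n j ≠ i) (f : ℕ → Bool) :
    stateCode M n i (j + 1) f = stateCode M n i j f := by
  have h : ∀ v, part M n v = i → (v < j + 1 ↔ v < j) := fun v hv => by
    have : v ≠ j := fun hc => hp (hc ▸ hv)
    omega
  have h1 : seen M n i (j + 1) = seen M n i j :=
    Finset.filter_congr fun v _ => or_congr_right (or_congr_right (and_congr_right (h v)))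
  have h2 : inside M n i (j + 1) f = inside M n i j f := by
    unfold inside
    congr 1
    exact Finset.filter_congr fun v _ => and_congr_right fun hv => and_congr_left' (h v hv)
  rw [stateCode, stateCode, h1, h2]

theorem seenCount_skip {i j : ℕ} (hp : part M n j ≠ i) :
    seenCount M n i (j + 1) = seenCount M n i j := by
  unfold seenCount
  congr 1
  refine Finset.filter_congr fun v _ => or_congr_right (and_congr_right fun hv => ?_)
  have : v ≠ j := fun hc => hp (hc ▸ hv)
  omega

theorem reached_skip {col : ℕ → ℕ} {i j : ℕ} (hp : part M n j ≠ i) :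
    reached M n col i (j + 1) = reached M n col i j := by
  simp only [reached, stateCode_skip hp]

theorem seenCount_end (i : ℕ) : seenCount M n (i + 1) 0 = seenCount M n i n := by
  unfold seenCount
  congr 1
  refine Finset.filter_congr fun v hv => ?_
  have := Finset.mem_range.mp hv
  omega

theorem seen_end (i : ℕ) : seen M n (i + 1) 0 = seen M n i n := by
  refine Finset.filter_congr fun v hv => or_congr_right ?_
  have := Finset.mem_range.mp hv
  omega

theorem before_end (i : ℕ) (f : ℕ → Bool) :
    before M n (i + 1) f true = before M n i f true + inside M n i n f := by
  unfold before inside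
  simp only [Finset.card_filter, ← Finset.sum_add_distrib]
  refine Finset.sum_congr rfl fun v hv => ?_
  have hv := Finset.mem_range.mp hv
  rcases lt_trichotomy (part M n v) i with h | h | h
  · have h1 : part M n v < i + 1 := by omega
    simp [h, h1, h.ne]
  · simp [h, hv]
  · have h1 : ¬ part M n v < i + 1 := by omega
    have h2 : ¬ part M n v < i := by omega
    simp [h1, h2, h.ne']

theorem inside_zero (i : ℕ) (f : ℕ → Bool) : inside M n i 0 f = 0 := by
  simp [inside]

/-- The same colorings occur on both sides and the seen set is unchanged; only the digit `q` is
merged into `r`. -/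
theorem reached_end {col : ℕ → ℕ} (i : ℕ) :
    reached M n col (i + 1) 0 = partEndSet M n (seenCount M n i 0) (reached M n col i n) := by
  have hle : ∀ f, before M n i f true < seenCount M n i 0 + 1 := fun f => by
    rw [← before_add_before i f]; omega
  have hin : ∀ f, inside M n i n f ≤ n := fun f => card_filter_range_le _
  have hcode : ∀ f, stateCode M n (i + 1) 0 f = (before M n i f true + inside M n i n f) * wR M n +
      pairsCode M n (seen M n i n) f := fun f => by
    rw [stateCode, before_end, inside_zero, seen_end, zero_mul, zero_add]
  ext a
  constructor
  · rintro ⟨f, hf, rfl⟩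
    exact ⟨_, hle f, _, Nat.lt_succ_of_le (hin f), _, pairsCode_lt (seen_subset i n) f,
      ⟨f, hf, by rw [stateCode]; ring⟩, hcode f⟩
  · rintro ⟨r, hr, q, hq, y, hy, ⟨f, hf, h⟩, rfl⟩
    rw [stateCode, add_assoc] at h
    obtain ⟨rfl, h⟩ := eq_of_digits (lower_lt (by omega) hy) (state_lt i n f) h
    obtain ⟨rfl, rfl⟩ := eq_of_digits hy (pairsCode_lt (seen_subset i n) f) (Nat.add_left_cancel h)
    exact ⟨f, hf, (hcode f).symm⟩

/-- Only the given set is seen, so all extensions of `col` have the same code; the extension that is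
blue elsewhere shows that one exists. -/
theorem reached_start {col : ℕ → ℕ} (hcol : IsColoringOfX M n col) :
    reached M n col 0 0 = {∑ u ∈ Finset.range n, ∑ v ∈ Finset.range n, pairCode M n col u v} := by
  have key : ∀ f, Extends M n col f → stateCode M n 0 0 f =
      ∑ u ∈ Finset.range n, ∑ v ∈ Finset.range n, pairCode M n col u v := by
    intro f hf
    have hb : before M n 0 f true = 0 := by simp [before]
    rw [stateCode, hb, inside_zero, zero_mul, zero_mul, zero_add, zero_add, pairsCode, monoPairs,
      monoPairs, Finset.sum_mul, ← Finset.sum_add_distrib, seen, Finset.sum_filter]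
    refine Finset.sum_congr rfl fun u hu => ?_
    have hu := Finset.mem_range.mp hu
    rw [Finset.sum_mul, ← Finset.sum_add_distrib, Finset.sum_filter]
    simp only [Nat.not_lt_zero, and_false, or_false]
    have hut := hf.color_iff hcol true u hu
    have huf := hf.color_iff hcol false u hu
    simp only [if_true, Bool.false_eq_true, if_false] at hut huf
    by_cases hX : InX M n u
    · rw [if_pos hX]
      refine Finset.sum_congr rfl fun v hv => ?_
      have hv := Finset.mem_range.mp hv
      have hvt := hf.color_iff hcol true v hv
      have hvf := hf.color_iff hcol false v hv
      simp only [if_true, Bool.false_eq_true, if_false] at hvt hvf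
      unfold pairCode
      by_cases hXv : InX M n v
      · cases hfu : f u <;> cases hfv : f v <;> simp_all
      · have hv0 := (hcol v hv).2 hXv
        cases hfu : f u <;> simp_all
    · have hu0 := (hcol u hu).2 hX
      simp [hX, pairCode, hu0]
  ext a
  constructor
  · rintro ⟨f, hf, rfl⟩
    exact key f hf
  · rintro rfl
    refine ⟨fun v => decide (col v = 1), fun v _ _ => by simp, (key _ fun v _ _ => by simp).symm⟩

/-- Representatives are below `n`, so after `n` parts every vertex is seen and the last two digits
count the monochromatic pairs of the whole graph. -/
theorem CoclusterInput.exists_reached_iff (hG : CoclusterInput M n) {col : ℕ → ℕ} (k₁ k₂ : ℕ) :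
    (∃ r < n + 1, ∃ e₁ < wE M n, ∃ e₂ < wE M n,
      r * wR M n + e₁ * wE M n + e₂ ∈ reached M n col n 0 ∧ k₁ ≤ e₁ ∧ k₂ ≤ e₂) ↔
    ∃ f, Extends M n col f ∧ k₁ ≤ monoPairs M n (Finset.range n) f true ∧
      k₂ ≤ monoPairs M n (Finset.range n) f false := by
  have hseen : seen M n n 0 = Finset.range n := by
    refine Finset.filter_true_of_mem fun v hv => ?_
    by_cases hX : InX M n v
    · exact Or.inl hX
    · exact Or.inr (Or.inl (hG.part_spec (Finset.mem_range.mp hv) hX).1)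
  have hcode : ∀ f, stateCode M n n 0 f = before M n n f true * wR M n +
      (monoPairs M n (Finset.range n) f true * wE M n +
        monoPairs M n (Finset.range n) f false) := fun f => by
    rw [stateCode, inside_zero, hseen, zero_mul, zero_add, pairsCode]
  have hQR : wQ M n ≤ wR M n := Nat.le_mul_of_pos_left _ (by omega)
  constructor
  · rintro ⟨r, hr, e₁, he₁, e₂, he₂, ⟨f, hf, h⟩, h1, h2⟩
    rw [hcode, add_assoc] at h
    have hlt : e₁ * wE M n + e₂ < wQ M n := by
      unfold wQ
      calc _ < e₁ * wE M n + wE M n := by omega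
        _ = (e₁ + 1) * wE M n := by ring
        _ ≤ _ := Nat.mul_le_mul_right _ he₁
    obtain ⟨rfl, h⟩ := eq_of_digits (hlt.trans_le hQR)
      ((pairsCode_lt (subset_refl _) f).trans_le hQR) h
    obtain ⟨rfl, rfl⟩ := eq_of_digits he₂ (monoPairs_lt (subset_refl _) f false)
      (Nat.add_left_cancel h)
    exact ⟨f, hf, h1, h2⟩
  · rintro ⟨f, hf, h1, h2⟩
    exact ⟨before M n n f true, Nat.lt_succ_of_le (card_filter_range_le _), _,
      monoPairs_lt (subset_refl _) f true, _, monoPairs_lt (subset_refl _) f false,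
      ⟨f, hf, by rw [hcode, add_assoc]⟩, h1, h2⟩

end DynamicProgram

/-! ### Correctness of the algorithm for a given set -/

/-- A bound on the running time for one coloring of the given set. -/
def roundTime (M : ℕ → ℕ) (n : ℕ) : ℕ :=
  n * 18 + 3 + (n * (n * 16 + 6) + 7) +
    (n * (n * (stepTime M n + 5) + partEndTime M n + 5) + 2) +
    ((n + 1) * (wE M n * (wE M n * 12 + 5) + 7) + 3) + 1

/-- A bound on the running time of the preparations. -/
def setupTime (M : ℕ → ℕ) (n : ℕ) : ℕ :=
  n * 5 + 5 + 12 + (n * (n * 10 + 5) + 2) + (wE M n * 4 + n * 8 + 18) + (n * 9 + 3) +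
    (n * (n * 13 + 10) + 2)

/-- There is a coloring with sufficiently many red and blue pairs. -/
def GoodColoring (M : ℕ → ℕ) (n : ℕ) : Prop :=
  ∃ f, 2 * M 1 ≤ monoPairs M n (Finset.range n) f true ∧
    2 * M 3 ≤ monoPairs M n (Finset.range n) f false

theorem colOf_isColoringOfX (M : ℕ → ℕ) (n c : ℕ) : IsColoringOfX M n (colOf M n c) := by
  intro v _
  unfold colOf
  constructor
  · intro h
    rw [if_pos h]
    split_ifs <;> simp
  · intro h
    rw [if_neg h]

theorem exists_colOf (M : ℕ → ℕ) (n : ℕ) (f : ℕ → Bool) :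
    ∃ c < 2 ^ Nat.count (InX M n) n, Extends M n (colOf M n c) f := by
  -- Bit `i` is the color of the `i`-th vertex of the given set; `Nat.nth` inverts the rank
  -- `Nat.count`.
  refine ⟨Nat.ofBits fun i : Fin (Nat.count (InX M n) n) => f (Nat.nth (InX M n) i),
    Nat.ofBits_lt_two_pow _, fun v hv hX => ?_⟩
  rw [colOf, if_pos hX, Nat.testBit_ofBits_lt _ _ (Nat.count_strict_mono hX hv)]
  simp only [Nat.nth_count hX]
  split_ifs with h <;> simp [h]

/-- `hfresh` lets every coloring of the given set start on unused cells. The final addition skips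
the last layer, whose codes are below `wB`. -/
theorem round_runs {M : ℕ → ℕ} {n c : ℕ} {P : Prop} {s : State} (hG : CoclusterInput M n)
    (hs : Ready M n s) (hc : s.reg rC = c) (hcK : c < 2 ^ Nat.count (InX M n) n)
    (hP : Answer s P) (hfresh : ∀ y, s.reg rBase ≤ y → s.arr 4 y = 0) :
    Runs (.decode;; .initTable;; .table;; .scan;; .add rBase rBase rB) s (roundTime M n)
      (fun s' => Answer s' (P ∨ ∃ f, Extends M n (colOf M n c) f ∧
        2 * M 1 ≤ monoPairs M n (Finset.range n) f true ∧
        2 * M 3 ≤ monoPairs M n (Finset.range n) f false) ∧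
        ∀ y, s'.reg rBase ≤ y → s'.arr 4 y = 0) := by
  have hcol := colOf_isColoringOfX M n c
  refine Runs.weaken ((decode_runs hs hc hcK).seq fun s1 hf1 h1 => ?_)
    (T := n * 18 + 3 + ((n * (n * 16 + 6) + 7) +
    ((n * (n * (stepTime M n + 5) + partEndTime M n + 5) + 2) +
    (((n + 1) * (wE M n * (wE M n * 12 + 5) + 7) + 3) + 1)))) (by unfold roundTime; omega)
    (fun _ _ h => h)
  have hR1 := hs.frame hf1 (by decide) (by decide)
  refine (initTable_runs hR1 h1 rfl).seq fun s2 hf2 h2 => ?_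
  have hR2 := hR1.frame hf2 (by decide) (by decide)
  have hbase2 : s2.reg rBase = s.reg rBase := by
    rw [hf2.reg _ (by decide), hf1.reg _ (by decide)]
  have hS2 : Shows s2 (reached M n (colOf M n c) 0 0) := by
    intro a
    rw [reached_start hcol, Cell, h2.2.2, hf1.arr 4 (by decide), hf2.reg rBase (by decide),
      hf1.reg rBase (by decide)]
    refine ⟨fun h => ?_, fun h => ?_⟩
    · rw [Set.mem_singleton_iff.mp h, Function.update_self]
    · rw [Function.update_of_ne]
      · exact hfresh _ (by omega)
      · intro hc
        exact h (Set.mem_singleton_iff.mpr (by omega))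
  have hTB : ∀ i j, ∀ a ∈ reached M n (colOf M n c) i j, a < wB M n := by
    rintro i j a ⟨f, -, rfl⟩
    exact stateCode_lt i j f
  have hcnt0 : seenCount M n 0 0 = 0 := by simp [seenCount]
  refine (table_runs (T := reached M n (colOf M n c)) (cnt := seenCount M n)
    (col := colOf M n c) hR2 (by rw [hf2.arr 3 (by decide)]; exact h1) (by rw [h2.1, hcnt0])
    (by rw [h2.2.1, hcnt0]) hS2 hTB (fun i => card_filter_range_le _)
    (fun i hi j hj hp => ⟨seenCount_succ hj hp, hG.reached_step hcol hi hj hp⟩)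
    (fun i _ j _ hp => ⟨seenCount_skip hp, reached_skip hp⟩)
    (fun i _ => ⟨seenCount_end i, reached_end i⟩)).seq fun s3 hf3 h3 => ?_
  have hR3 := hR2.frame hf3 (by decide) (by decide)
  have hP3 : Answer s3 P := by
    unfold Answer
    rw [hf3.reg _ (by decide), hf2.reg _ (by decide), hf1.reg _ (by decide)]
    exact hP
  refine (scan_runs hR3 h3 hP3).seq fun s4 hf4 h4 => Runs.eval rfl le_rfl ⟨?_, ?_⟩
  · have h5 := h4.congr (or_congr_right (hG.exists_reached_iff (2 * M 1) (2 * M 3)))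
    simpa [Answer, Prog.eval] using h5
  · have hR4 := hR3.frame hf4 (by decide) (by decide)
    intro y hy
    simp only [Prog.eval, State.setReg_reg, State.setReg_arr, if_true] at hy ⊢
    rw [hf4.reg _ (by decide), hR4.b] at hy
    rw [hf4.arr 4 (by decide)]
    obtain ⟨d, rfl⟩ := Nat.exists_eq_add_of_le hy
    rw [add_assoc]
    exact (h3 _).2 fun hc => by have := hTB _ _ _ hc; omega

theorem setup_runs {M : ℕ → ℕ} {n : ℕ} {s : State} {q : Prog} {T : ℕ} {Q : State → Prop}
    (h0 : s.arr 0 = M) (hn : M 0 = n)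
    (hq : ∀ s', Ready M n s' → s'.reg 0 = 0 → s'.reg rBase = 0 → s'.arr 4 = s.arr 4 →
      Runs q s' T Q) :
    Runs (.setupRows;; .setupTargets;; .countPairs;; .setupWeights;; .setupPowers;;
      .setupParts;; q) s (setupTime M n + T) Q := by
  have hrows := setupRows_runs s
  rw [h0, hn] at hrows
  refine Runs.weaken (T := (n * 5 + 5) + (12 + ((n * (n * 10 + 5) + 2) +
    ((wE M n * 4 + n * 8 + 18) + ((n * 9 + 3) + ((n * (n * 13 + 10) + 2) + T))))))
    ?_ (by unfold setupTime; omega) (fun _ _ h => h)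
  refine hrows.seq fun s1 hf1 hL1 => (setupTargets_runs hL1).seq fun s2 hf2 h2 => ?_
  have hL2 := hL1.frame hf2 (by decide)
  refine (countPairs_runs hL2 h2.2.2.2.2.2).seq fun s3 hf3 h3 => ?_
  have hL3 := hL2.frame hf3 (by decide)
  refine (setupWeights_runs h3 (by rw [hf3.reg _ (by decide), h2.2.2.1])).seq fun s4 hf4 h4 => ?_
  have hL4 := hL3.frame hf4 (by decide)
  refine (setupPowers_runs hL4).seq fun s5 hf5 h5 => ?_
  have hL5 := hL4.frame hf5 (by decide)
  refine (setupParts_runs hL5).seq fun s6 hf6 h6 => ?_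
  have hL6 := hL5.frame hf6 (by decide)
  have e2 : ∀ r, r ∉ Prog.setupParts.regs ++ Prog.setupPowers.regs ++ Prog.setupWeights.regs ++
      Prog.countPairs.regs → s6.reg r = s2.reg r := fun r hr => by
    simp only [List.mem_append, not_or] at hr
    rw [hf6.reg r hr.1.1.1, hf5.reg r hr.1.1.2, hf4.reg r hr.1.2, hf3.reg r hr.2]
  refine hq s6 ⟨hL6, ?_, ?_, ?_, ?_, ?_, ?_, ?_, ?_, ?_, ?_, h6⟩ ?_ ?_ ?_
  · rw [e2 _ (by decide), h2.1]
  · rw [e2 _ (by decide), h2.2.1]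
  · rw [e2 _ (by decide), h2.2.2.1]
  · rw [hf6.reg _ (by decide), hf5.reg _ (by decide), hf4.reg _ (by decide), h3]
  · rw [hf6.reg _ (by decide), hf5.reg _ (by decide), h4.1]
  · rw [hf6.reg _ (by decide), hf5.reg _ (by decide), h4.2.1]
  · rw [hf6.reg _ (by decide), hf5.reg _ (by decide), h4.2.2.1]
  · rw [hf6.reg _ (by decide), hf5.reg _ (by decide), h4.2.2.2]
  · rw [hf6.reg _ (by decide), h5.1]
  · rw [hf6.arr 1 (by decide)]; exact h5.2
  · rw [e2 _ (by decide), h2.2.2.2.1]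
  · rw [e2 _ (by decide), h2.2.2.2.2.1]
  · rw [hf6.arr 4 (by decide), hf5.arr 4 (by decide), hf4.arr 4 (by decide),
      hf3.arr 4 (by decide), hf2.arr 4 (by decide), hf1.arr 4 (by decide)]

-- The rounds form a disjunction over all colorings of the given set, and every `f` extends one of
-- them.
set_option maxRecDepth 4000 in
theorem solver_runs {M : ℕ → ℕ} {n : ℕ} {s : State} (hG : CoclusterInput M n) (h0 : s.arr 0 = M)
    (hn : M 0 = n) (h4 : ∀ y, s.arr 4 y = 0) :
    Runs .solver s (setupTime M n + (2 ^ Nat.count (InX M n) n * (roundTime M n + 3) + 2))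
      (fun s' => Answer s' (GoodColoring M n)) := by
  refine setup_runs h0 hn fun s1 hR1 hans hbase harr => ?_
  refine (Runs.forLt (T := roundTime M n) (I := fun k s' => Answer s' (∃ c < k, ∃ f,
    Extends M n (colOf M n c) f ∧ 2 * M 1 ≤ monoPairs M n (Finset.range n) f true ∧
      2 * M 3 ≤ monoPairs M n (Finset.range n) f false) ∧ ∀ y, s'.reg rBase ≤ y → s'.arr 4 y = 0)
    (by decide) (by simp [Answer, hans, harr, h4]) ?_).weaken (by rw [hR1.k]) ?_
  · intro k s2 hk hf2 hc2 hI2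
    rw [hR1.k] at hk
    have hR2 := hR1.frame hf2 (by decide) (by decide)
    refine (round_runs hG hR2 hc2 hk hI2.1 hI2.2).weaken le_rfl fun s3 _ h3 => ⟨?_, ?_⟩
    · have h5 := h3.1.congr (P' := ∃ c < k + 1, ∃ f,
        Extends M n (colOf M n c) f ∧ 2 * M 1 ≤ monoPairs M n (Finset.range n) f true ∧
        2 * M 3 ≤ monoPairs M n (Finset.range n) f false) (by
          constructor
          · rintro (⟨c, hc, h⟩ | h)
            · exact ⟨c, by omega, h⟩
            · exact ⟨k, by omega, h⟩
          · rintro ⟨c, hc, h⟩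
            rcases Nat.lt_succ_iff_lt_or_eq.mp hc with hc | rfl
            · exact Or.inl ⟨c, hc, h⟩
            · exact Or.inr h)
      simpa [Answer] using h5
    · simpa using h3.2
  · intro s2 _ h2
    rw [hR1.k] at h2
    refine h2.1.congr ⟨?_, ?_⟩
    · rintro ⟨c, -, f, -, h⟩
      exact ⟨f, h⟩
    · rintro ⟨f, h⟩
      obtain ⟨c, hc, hext⟩ := exists_colOf M n f
      exact ⟨c, hc, f, hext, h⟩

/-! ### From words to graphs -/

/-- Components of the complement are complete iff non-adjacency is transitive. The backward
direction shortens a path of the complement edge by edge, keeping its ends non-adjacent in `G`. -/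
theorem isCoclusterModulator_iff {V : Type*} {G : SimpleGraph V} {X : Finset V} :
    IsCoclusterModulator G X ↔ ∀ u v w, u ∉ X → v ∉ X → w ∉ X → ¬ G.Adj u v → ¬ G.Adj v w →
      ¬ G.Adj u w := by
  constructor
  · intro h u v w hu hv hw huv hvw huw
    by_cases h1 : u = v
    · exact hvw (h1 ▸ huw)
    by_cases h2 : v = w
    · exact huv (h2 ▸ huw)
    have hc := h ⟨u, hu⟩ ⟨w, hw⟩ (SimpleGraph.Reachable.trans
      (SimpleGraph.Adj.reachable (v := ⟨v, hv⟩) (by simpa [h1] using huv))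
      (SimpleGraph.Adj.reachable (by simpa [h2] using hvw))) (by simpa using huw.ne)
    rw [SimpleGraph.compl_adj] at hc
    exact hc.2 (by simpa using huw)
  · intro h u v huv hne
    rw [SimpleGraph.compl_adj]
    refine ⟨hne, ?_⟩
    rw [SimpleGraph.reachable_iff_reflTransGen] at huv
    clear hne
    induction huv with
    | refl => simp
    | @tail v w _ hbc ih =>
      rw [SimpleGraph.compl_adj] at hbc
      simp only [SimpleGraph.comap_adj] at ih hbc ⊢
      exact h _ _ _ u.2 v.2 w.2 ih hbc.2

-- Handshake lemma: the inner sums are the degrees.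
open Classical in
theorem sum_adj_eq_twice_edges {n : ℕ} (H : SimpleGraph (Fin n)) :
    ∑ u, ∑ v, (if H.Adj u v then 1 else 0) = 2 * H.edgeSet.ncard := by
  rw [Set.ncard_eq_toFinset_card', ← SimpleGraph.edgeFinset, ← H.sum_degrees_eq_twice_card_edges]
  refine Finset.sum_congr rfl fun u _ => ?_
  rw [← SimpleGraph.card_neighborFinset_eq_degree, SimpleGraph.neighborFinset_eq_filter,
    Finset.card_filter]

/-- The word `M` encodes the instance `I` and the set `X`. -/
structure Reads (I : LoadInstance) (X : Finset (Fin I.n)) (M : ℕ → ℕ) : Prop where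
  num : M 0 = I.n
  k1 : M 1 = I.k₁.toNat
  k2 : M 3 = I.k₂.toNat
  adj : ∀ u v : Fin I.n, Adj M I.n u v ↔ I.G.Adj u v
  inX : ∀ v : Fin I.n, InX M I.n v ↔ v ∈ X

theorem getD_encode_adj (I : LoadInstance) (l : List ℕ) (u v : Fin I.n) :
    (I.encode ++ l).getD (5 + u * I.n + v) 0 = 1 ↔ I.G.Adj u v := by
  classical
  have hlt : (u : ℕ) * I.n + v < I.n * I.n := by
    have := row_lt u.2 v.2; omega
  have hlen : 5 + (u : ℕ) * I.n + v < I.encode.length := by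
    simp [LoadInstance.encode]; omega
  rw [List.getD_append _ _ _ _ hlen, LoadInstance.encode, List.getD_append_right _ _ _ _ (by simp; omega)]
  have hidx : 5 + (u : ℕ) * I.n + v - [I.n, I.k₁.toNat, (-I.k₁).toNat, I.k₂.toNat,
      (-I.k₂).toNat].length = u * I.n + v := by simp; omega
  have hpos : 0 < I.n := u.pos
  rw [hidx, List.getD_eq_getElem _ _ (by simpa using hlt), List.getElem_ofFn]
  have h1 : Fin.divNat (⟨u * I.n + v, hlt⟩ : Fin (I.n * I.n)) = u := by
    ext
    simp only [Fin.coe_divNat]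
    rw [mul_comm, Nat.mul_add_div hpos, Nat.div_eq_of_lt v.2, add_zero]
  have h2 : Fin.modNat (⟨u * I.n + v, hlt⟩ : Fin (I.n * I.n)) = v := by
    ext
    simp only [Fin.coe_modNat]
    rw [mul_comm, Nat.mul_add_mod, Nat.mod_eq_of_lt v.2]
  rw [h1, h2]
  by_cases h : I.G.Adj u v <;> simp [h]

theorem length_encode (I : LoadInstance) : I.encode.length = 5 + I.n * I.n := by
  simp [LoadInstance.encode]; omega

theorem reads_encodeWith (I : LoadInstance) (X : Finset (Fin I.n)) :
    Reads I X (fun i => (I.encodeWith X).getD i 0) := by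
  refine ⟨rfl, rfl, rfl, fun u v => getD_encode_adj I _ u v, fun v => ?_⟩
  rw [InX, LoadInstance.encodeWith, List.getD_append_right _ _ _ _ (by rw [length_encode]; omega),
    length_encode, Nat.add_sub_cancel_left, List.getD_eq_getElem _ _ (by simp), List.getElem_ofFn]
  by_cases h : v ∈ X <;> simp [h]

/-- Cells behind the input are 0, so a missing indicator vector reads as the empty set. -/
theorem reads_encode (I : LoadInstance) : Reads I ∅ (fun i => I.encode.getD i 0) := by
  refine ⟨rfl, rfl, rfl, fun u v => ?_, fun v => ?_⟩
  · have := getD_encode_adj I [] u v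
    rwa [List.append_nil] at this
  · rw [InX, List.getD_eq_default _ _ (by rw [length_encode]; omega)]
    simp

theorem Reads.coclusterInput {I : LoadInstance} {X : Finset (Fin I.n)} {M : ℕ → ℕ}
    (h : Reads I X M) (hX : IsCoclusterModulator I.G X) : CoclusterInput M I.n := by
  rw [isCoclusterModulator_iff] at hX
  refine ⟨fun u hu v hv => ?_, fun u hu => ?_, fun u hu v hv w hw => ?_⟩
  · have h1 := h.adj ⟨u, hu⟩ ⟨v, hv⟩
    have h2 := h.adj ⟨v, hv⟩ ⟨u, hu⟩
    simp only at h1 h2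
    rw [h1, h2]
    exact fun h => h.symm
  · have h1 := h.adj ⟨u, hu⟩ ⟨u, hu⟩
    simp only at h1
    rw [h1]
    exact I.G.irrefl
  · have := hX ⟨u, hu⟩ ⟨v, hv⟩ ⟨w, hw⟩
    rw [← h.inX, ← h.inX, ← h.inX, ← h.adj, ← h.adj, ← h.adj] at this
    exact this

theorem Reads.pairCount {I : LoadInstance} {X : Finset (Fin I.n)} {M : ℕ → ℕ}
    (h : Reads I X M) : pairCount M I.n = 2 * I.G.edgeSet.ncard := by
  classical
  rw [← sum_adj_eq_twice_edges, RAM.pairCount, Finset.sum_range]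
  refine Finset.sum_congr rfl fun u _ => ?_
  rw [Finset.sum_range]
  exact Finset.sum_congr rfl fun v _ => if_congr (h.adj u v) rfl rfl

theorem Reads.count_inX {I : LoadInstance} {X : Finset (Fin I.n)} {M : ℕ → ℕ}
    (h : Reads I X M) : Nat.count (InX M I.n) I.n = X.card := by
  rw [Nat.count_eq_card_filter_range, ← Finset.card_map Fin.valEmbedding]
  congr 1
  ext v
  simp only [Finset.mem_filter, Finset.mem_range, Finset.mem_map, Fin.valEmbedding_apply]
  constructor
  · rintro ⟨hv, hX⟩
    exact ⟨⟨v, hv⟩, (h.inX ⟨v, hv⟩).mp hX, rfl⟩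
  · rintro ⟨u, hu, rfl⟩
    exact ⟨u.2, (h.inX u).mpr hu⟩

theorem Reads.monoPairs {I : LoadInstance} {X : Finset (Fin I.n)} {M : ℕ → ℕ}
    (h : Reads I X M) {f : ℕ → Bool} {b : Bool} {g : Fin I.n → Color} {c : Color}
    (hfg : ∀ v : Fin I.n, f v = b ↔ g v = c) :
    monoPairs M I.n (Finset.range I.n) f b = 2 * monoEdges I.G g c := by
  classical
  -- The monochromatic edges form a graph, to which the handshake lemma applies.
  let H : SimpleGraph (Fin I.n) :=
    { Adj := fun u v => I.G.Adj u v ∧ g u = c ∧ g v = c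
      symm := ⟨fun u v huv => ⟨huv.1.symm, huv.2.2, huv.2.1⟩⟩
      loopless := ⟨fun u hu => I.G.irrefl hu.1⟩ }
  have hH : {e : Sym2 (Fin I.n) | e ∈ I.G.edgeSet ∧ ∀ v ∈ e, g v = c} = H.edgeSet := by
    ext e
    induction e with
    | h u v => simp [H]
  rw [monoEdges, hH, ← sum_adj_eq_twice_edges, RAM.monoPairs, Finset.sum_range]
  refine Finset.sum_congr rfl fun u _ => ?_
  rw [Finset.sum_range]
  refine Finset.sum_congr rfl fun v _ => ?_
  have huv : Adj M I.n u v ∧ f u = b ∧ f v = b ↔ H.Adj u v :=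
    and_congr (h.adj u v) (and_congr (hfg u) (hfg v))
  by_cases hH : H.Adj u v
  · rw [if_pos (huv.mpr hH), if_pos hH]
  · rw [if_neg (mt huv.mp hH), if_neg hH]

theorem Reads.goodColoring_iff {I : LoadInstance} {X : Finset (Fin I.n)} {M : ℕ → ℕ}
    (h : Reads I X M) : GoodColoring M I.n ↔ HasLoadColoring I.G I.k₁ I.k₂ := by
  classical
  unfold GoodColoring HasLoadColoring
  rw [h.k1, h.k2]
  -- Edge counts are nonnegative, so a negative target is equivalent to the target 0.
  simp only [← Int.toNat_le]
  constructor
  · rintro ⟨f, h1, h2⟩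
    refine ⟨fun v => if f v then .red else .blue, ?_⟩
    rw [h.monoPairs (c := .red) (g := fun v => if f v then .red else .blue) (fun v => by
      cases f v <;> simp)] at h1
    rw [h.monoPairs (c := .blue) (g := fun v => if f v then .red else .blue) (fun v => by
      cases f v <;> simp)] at h2
    constructor <;> omega
  · rintro ⟨g, h1, h2⟩
    let f : ℕ → Bool := fun v => if hv : v < I.n then decide (g ⟨v, hv⟩ = .red) else true
    have e1 := h.monoPairs (f := f) (b := true) (c := .red) (g := g) (fun v => by simp [f])
    have e2 := h.monoPairs (f := f) (b := false) (c := .blue) (g := g) (fun v => by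
      cases hv : g v <;> simp [f, hv])
    exact ⟨f, by omega, by omega⟩

/-! ### Running times -/

theorem totalTime_le {M : ℕ → ℕ} {n m : ℕ} (hw : pairCount M n = 2 * m) :
    setupTime M n + roundTime M n + 5 ≤ 1600 * (max n 1 ^ 4 * max m 1 ^ 2) := by
  -- The bound is monotone in `n` and `W`, so `n ≤ x + 1` and `W = 1 + 2m ≤ 3(y + 1)` may be
  -- inserted. Expanded in `x` and `y`, the difference of the two sides has only nonnegative
  -- coefficients.
  obtain ⟨x, hx⟩ : ∃ x, max n 1 = x + 1 := ⟨max n 1 - 1, by omega⟩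
  obtain ⟨y, hy⟩ : ∃ y, max m 1 = y + 1 := ⟨max m 1 - 1, by omega⟩
  have hn : n ≤ x + 1 := by omega
  have hW : wE M n ≤ 3 * (y + 1) := by unfold wE; omega
  rw [hx, hy]
  unfold setupTime roundTime stepTime partEndTime wR wQ
  generalize wE M n = W at hW
  let F : ℕ → ℕ → ℕ := fun n W =>
    n * 5 + 5 + 12 + (n * (n * 10 + 5) + 2) + (W * 4 + n * 8 + 18) + (n * 9 + 3) +
      (n * (n * 13 + 10) + 2) + (n * 18 + 3 + (n * (n * 16 + 6) + 7) +
      (n * (n * (n * 17 + 16 + (n + 1) * ((n + 1) * (W * W) * 18 + 16) + 5) +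
        ((n + 1) * ((n + 1) * (W * W * 9 + 9) + 7) + 11) + 5) + 2) +
      ((n + 1) * (W * (W * 12 + 5) + 7) + 3) + 1) + 5
  calc F n W ≤ F (x + 1) (3 * (y + 1)) := by
        simp only [F]
        gcongr
    _ ≤ 1600 * ((x + 1) ^ 4 * (y + 1) ^ 2) := by
      simp only [F]
      zify
      rw [← sub_nonneg]
      ring_nf
      positivity

theorem solver_answers {I : LoadInstance} {X : Finset (Fin I.n)} {M : ℕ → ℕ} (h : Reads I X M)
    (hX : IsCoclusterModulator I.G X) {s : State} (h0 : s.arr 0 = M) (h4 : ∀ y, s.arr 4 y = 0) :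
    Runs .solver s (1600 * (2 ^ X.card * max I.n 1 ^ 4 * max I.G.edgeSet.ncard 1 ^ 2))
      (fun s' => Answer s' (HasLoadColoring I.G I.k₁ I.k₂)) := by
  refine (solver_runs (h.coclusterInput hX) h0 h.num h4).weaken ?_
    (fun s' _ h' => h'.congr h.goodColoring_iff)
  rw [h.count_inX]
  have ht := totalTime_le h.pairCount
  have hK : 1 ≤ 2 ^ X.card := Nat.one_le_two_pow
  -- The preparations run once; charging them to every coloring makes the power of two a common
  -- factor.
  calc setupTime M I.n + (2 ^ X.card * (roundTime M I.n + 3) + 2)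
      ≤ 2 ^ X.card * setupTime M I.n + (2 ^ X.card * (roundTime M I.n + 3) + 2 ^ X.card * 2) :=
        Nat.add_le_add (Nat.le_mul_of_pos_left _ hK)
          (Nat.add_le_add_left (Nat.le_mul_of_pos_left _ hK) _)
    _ = 2 ^ X.card * (setupTime M I.n + roundTime M I.n + 5) := by ring
    _ ≤ 2 ^ X.card * (1600 * (max I.n 1 ^ 4 * max I.G.edgeSet.ncard 1 ^ 2)) :=
        Nat.mul_le_mul_left _ ht
    _ = _ := by ring

theorem Runs.answersWithin {p : Prog} {w : List ℕ} {T : ℕ} {Q : Prop}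
    (h : Runs p (initial w) T (fun s => Answer s Q)) : AnswersWithin p w Q T := by
  obtain ⟨t, s, he, ht, hs⟩ := h
  exact ⟨t, s, he, ht, hs⟩

/-- The infimum is attained because deleting all vertices is allowed. -/
theorem exists_modulator {V : Type*} [Fintype V] (G : SimpleGraph V) :
    ∃ X : Finset V, X.card = distToCocluster G ∧ IsCoclusterModulator G X :=
  Nat.sInf_mem (s := {k : ℕ | ∃ X : Finset V, X.card = k ∧ IsCoclusterModulator G X})
    ⟨_, Finset.univ, rfl, isCoclusterModulator_iff.mpr fun u _ _ hu =>
      absurd (Finset.mem_univ u) hu⟩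

/-- The algorithm that is not given a modulator. -/
def Prog.fullSolver : Prog := .setupRows;; .greedy;; .solver

theorem IsPacked.card_le {I : LoadInstance} {M : ℕ → ℕ} (h : Reads I ∅ M) {X : Finset ℕ}
    (hX : IsPacked (Adj M I.n) I.n X) : X.card ≤ 3 * distToCocluster I.G := by
  obtain ⟨Y, hYd, hY⟩ := exists_modulator I.G
  rw [isCoclusterModulator_iff] at hY
  have h1 := hX.2 (Y.map Fin.valEmbedding) (by
    rintro u hu v hv w hw ⟨⟨h1, h2, h3⟩, h4, h5, h6⟩
    have hadj : ∀ a b (ha : a < I.n) (hb : b < I.n),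
        Adj M I.n a b ↔ I.G.Adj ⟨a, ha⟩ ⟨b, hb⟩ := fun a b ha hb => h.adj ⟨a, ha⟩ ⟨b, hb⟩
    have hmem : ∀ a (ha : a < I.n), a ∉ Y.map Fin.valEmbedding → (⟨a, ha⟩ : Fin I.n) ∉ Y :=
      fun a ha hc hY => hc (Finset.mem_map.mpr ⟨_, hY, rfl⟩)
    rw [hadj u v hu hv] at h4
    rw [hadj u w hu hw] at h5
    rw [hadj v w hv hw] at h6
    -- The isolated vertex `w` is the middle one: it is non-adjacent to `u` and to `v`, yet `u` and
    -- `v` are adjacent.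
    exact hY _ _ _ (hmem u hu h1) (hmem w hw h3) (hmem v hv h2) h5 (fun hc => h6 hc.symm) h4)
  have h2 := Finset.card_le_card (Finset.inter_subset_right (s₁ := X)
    (s₂ := Y.map Fin.valEmbedding))
  rw [Finset.card_map, hYd] at h2
  omega

theorem Reads.mark {I : LoadInstance} {M : ℕ → ℕ} (h : Reads I ∅ M)
    (hM : ∀ v, M (5 + I.n * I.n + v) = 0) (X : Finset ℕ) :
    Reads I {v | (v : ℕ) ∈ X} (mark M I.n X) := by
  refine ⟨?_, ?_, ?_, fun u v => ?_, fun v => ?_⟩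
  · rw [mark_of_lt X (by omega), h.num]
  · rw [mark_of_lt X (by omega), h.k1]
  · rw [mark_of_lt X (by omega), h.k2]
  · rw [← h.adj u v, Adj, mark_of_lt X (row_lt u.2 v.2), Adj]
  · rw [InX, mark_add hM]
    simp

/-- The input length satisfies `n² ≤ L` and `m ≤ L`, so `n⁴m² ≤ L⁴`. The greedy phase is cubic in
`n` and is absorbed. -/
theorem fullSolver_time {n m d k L : ℕ} (hL : L = 5 + n * n) (hm : 2 * m ≤ n * n)
    (hk : k ≤ 3 * d) :
    n * 5 + 5 + (n * ((n * ((n * (40 + 3) + 2) + 3) + 2) + 3) + 2 +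
      1600 * (2 ^ k * max n 1 ^ 4 * max m 1 ^ 2)) ≤ 1700 * 8 ^ d * L ^ 4 := by
  have h8 : 2 ^ k ≤ 8 ^ d := by
    calc 2 ^ k ≤ 2 ^ (3 * d) := Nat.pow_le_pow_right (by omega) hk
      _ = 8 ^ d := by rw [pow_mul]; norm_num
  have hn : max n 1 ^ 2 ≤ L := by
    rcases Nat.eq_zero_or_pos n with rfl | hn
    · simp [hL]
    · rw [max_eq_left hn, hL, sq]; omega
  have hm' : max m 1 ≤ L := by rw [hL]; omega
  have h1 : 2 ^ k * max n 1 ^ 4 * max m 1 ^ 2 ≤ 8 ^ d * L ^ 4 := by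
    calc 2 ^ k * max n 1 ^ 4 * max m 1 ^ 2 = 2 ^ k * (max n 1 ^ 2) ^ 2 * max m 1 ^ 2 := by ring
      _ ≤ 8 ^ d * L ^ 2 * L ^ 2 := by gcongr
      _ = 8 ^ d * L ^ 4 := by ring
  have h2 : n * 5 + 5 + (n * ((n * ((n * (40 + 3) + 2) + 3) + 2) + 3) + 2) ≤ 100 * L ^ 4 := by
    have hnL : n ≤ L := by nlinarith
    have hL1 : 5 ≤ L := by omega
    have e3 : n * (n * n) ≤ L * L := by nlinarith
    have e4 : L * L ≤ L ^ 4 := by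
      calc L * L = L ^ 2 := (sq L).symm
        _ ≤ L ^ 4 := Nat.pow_le_pow_right (by omega) (by omega)
    nlinarith
  have h3 : L ^ 4 ≤ 8 ^ d * L ^ 4 := Nat.le_mul_of_pos_left _ (by positivity)
  calc _ = (n * 5 + 5 + (n * ((n * ((n * (40 + 3) + 2) + 3) + 2) + 3) + 2)) +
        1600 * (2 ^ k * max n 1 ^ 4 * max m 1 ^ 2) := by ring
    _ ≤ 100 * (8 ^ d * L ^ 4) + 1600 * (8 ^ d * L ^ 4) :=
        Nat.add_le_add (h2.trans (Nat.mul_le_mul_left _ h3)) (Nat.mul_le_mul_left _ h1)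
    _ = _ := by ring

theorem pairCount_le (M : ℕ → ℕ) (n : ℕ) : pairCount M n ≤ n * n := by
  calc pairCount M n ≤ ∑ _u ∈ Finset.range n, ∑ _v ∈ Finset.range n, 1 :=
        Finset.sum_le_sum fun u _ => Finset.sum_le_sum fun v _ => by split_ifs <;> omega
    _ = n * n := by simp

theorem fullSolver_answers (I : LoadInstance) :
    AnswersWithin .fullSolver I.encode (HasLoadColoring I.G I.k₁ I.k₂)
      (1700 * 8 ^ distToCocluster I.G * I.encode.length ^ 4) := by
  have hM := reads_encode I
  have hzero : ∀ v, I.encode.getD (5 + I.n * I.n + v) 0 = 0 := fun v =>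
    List.getD_eq_default _ _ (by rw [length_encode]; omega)
  have h0 : (initial I.encode).arr 0 = fun i => I.encode.getD i 0 := rfl
  refine Runs.answersWithin ?_
  have hrows := setupRows_runs (initial I.encode)
  rw [h0] at hrows
  change Runs _ _ (I.n * 5 + 5) (Loaded (fun i => I.encode.getD i 0) I.n) at hrows
  refine (hrows.seq fun s1 hf1 hL1 => (greedy_runs hzero hL1).seq fun s2 hf2 h2 => ?_).weaken
    (fullSolver_time (k := 3 * distToCocluster I.G) (length_encode I)
      (hM.pairCount ▸ pairCount_le _ _) le_rfl) (fun _ _ h => h)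
  obtain ⟨X, hX, hX0, hbad⟩ := h2
  have hR := hM.mark hzero X
  refine (solver_answers hR ?_ hX0 fun y => ?_).weaken ?_ (fun _ _ h => h)
  · rw [isCoclusterModulator_iff]
    intro u v w hu hv hw huv hvw huw
    simp only [Finset.mem_filter, Finset.mem_univ, true_and] at hu hv hw
    refine hbad u u.2 w w.2 v v.2 trivial ⟨⟨hu, hw, hv⟩, ?_, ?_, ?_⟩
    · exact (hM.adj u w).mpr huw
    · exact fun hc => huv ((hM.adj u v).mp hc)
    · exact fun hc => hvw ((hM.adj w v).mp hc).symm
  · rw [hf2.arr 4 (by decide), hf1.arr 4 (by decide)]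
    rfl
  · gcongr
    · omega
    · refine le_trans ?_ (hX.card_le hM)
      rw [← Finset.card_map Fin.valEmbedding]
      refine Finset.card_le_card fun v hv => ?_
      simp only [Finset.mem_map, Finset.mem_filter, Finset.mem_univ, true_and,
        Fin.valEmbedding_apply] at hv
      obtain ⟨u, hu, rfl⟩ := hv
      exact hu

theorem computable_time : Computable fun d : ℕ => 1700 * 8 ^ d := by
  refine Primrec.to_comp ?_
  have : Primrec fun d : ℕ => (1700 * 8 ^ d : ℕ) := by
    have h : Primrec (Nat.rec (motive := fun _ => ℕ) 1700 fun _ y => y * 8) :=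
      Primrec.nat_rec₁ 1700 (Primrec.nat_mul.comp₂ Primrec₂.right (Primrec₂.const 8))
    refine h.of_eq fun d => ?_
    induction d with
    | zero => rfl
    | succ d ih => simp only [ih]; ring
  exact this

end RAM

/-- 2-Load Coloring is fixed-parameter tractable parameterized by the distance to co-cluster graphs,
and it is solved in time `O(2 ^ |X| * n ^ 4 * m ^ 2)` if a set `X` of vertices is given whose
deletion leaves a co-cluster graph (factors `n` and `m` that vanish are read as `1`). -/
theorem theorem4 :
    loadColoringByCocluster.IsFPT ∧
    ∃ (p : RAM.Prog) (C : ℕ), ∀ (I : LoadInstance) (X : Finset (Fin I.n)),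
      IsCoclusterModulator I.G X →
        RAM.AnswersWithin p (I.encodeWith X) (HasLoadColoring I.G I.k₁ I.k₂)
          (C * (2 ^ X.card * max I.n 1 ^ 4 * max I.G.edgeSet.ncard 1 ^ 2)) :=
  ⟨⟨.fullSolver, fun d => 1700 * 8 ^ d, 4, RAM.computable_time, RAM.fullSolver_answers⟩,
    .solver, 1600, fun I X hX => RAM.Runs.answersWithin
      (RAM.solver_answers (RAM.reads_encodeWith I X) hX rfl fun _ => rfl)⟩
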